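/- Let $K$ be a field of characteristic $0$, let $c_1,\dots,c_9$ be independent indeterminates over $K$, let $F=K(c_1,\dots,c_9)$ and let $\Omega$ be an algebraic closure of $F$. Consider the general equation of the ninth degree $$f(x)=x^9+c_1x^8+\cdots+c_9=0$$ with roots $x_1,\dots,x_9\in\Omega$. Then there are a finite tower of fields $F=L_0\subseteq L_1\subseteq\cdots\subseteq L_r=L\subseteq\Omega$ and parameters $a_0,\dots,a_8\in L$ with the following properties. 1. For each $i<r$ one has $L_{i+1}=L_i(\theta_i)$, where $\theta_i$ is a root of a nonzero polynomial of degree $d_i\le 6$ with coefficients in $L_i$ (an auxiliary equation); at most one of the $d_i$ equals $5$ and at most one equals $6$. 2. The Tschirnhaus transformation $y=a_0+a_1x+\cdots+a_8x^8$ transforms $f(x)=0$ into an equation with $C_1=C_2=C_3=C_4=0$, that is, $$\prod_{k=1}^{9}\bigl(Y-(a_0+a_1x_k+\cdots+a_8x_k^8)\bigr)=Y^9+C_5Y^4+C_6Y^3+C_7Y^2+C_8Y+C_9$$ with $C_5,\dots,C_9\in L$. 3. The transformation is invertible over $L$: there are $b_0,\dots,b_8\in L$ such that $x_k=b_0+b_1y_k+\cdots+b_8y_k^8$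 for $k=1,\dots,9$, where $y_k=a_0+a_1x_k+\cdots+a_8x_k^8$. In particular the $a_j$ are not all zero. -/

import Mathlib

open Polynomial

noncomputable section

namespace NinthDegree

/-- The field of rational functions in nine independent indeterminates over `K`
(the coefficients of the general equation of the ninth degree). -/
abbrev CoeffField (K : Type*) [Field K] : Type _ :=
  FractionRing (MvPolynomial (Fin 9) K)

/-- An algebraically closed field in which all auxiliary equations are solved. -/
abbrev Closure (K : Type*) [Field K] : Type _ :=
  AlgebraicClosure (CoeffField K)

/-- The left side of the general equation of the ninth degree,
`x ^ 9 + c₁ x ^ 8 + ⋯ + c₉`; the indeterminate with index `i` in `{0, …, 8}` is `c_{i+1}`. -/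
def generalPoly (K : Type*) [Field K] : (CoeffField K)[X] :=
  X ^ 9 + ∑ i : Fin 9,
    C (algebraMap (MvPolynomial (Fin 9) K) (CoeffField K) (MvPolynomial.X i)) *
      X ^ (8 - (i : ℕ))

/-- The value `a₀ + a₁ x + ⋯ + a₈ x ^ 8`. -/
def tschirnhausValue {R : Type*} [CommRing R] (a : Fin 9 → R) (x : R) : R :=
  ∑ j : Fin 9, a j * x ^ (j : ℕ)

/-- The left side of the equation for `y = a₀ + a₁ x + ⋯ + a₈ x ^ 8`, where `x` runs through
the roots of `f` (with multiplicity): the product of the `Y - (a₀ + a₁ x + ⋯ + a₈ x ^ 8)`. -/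
def tschirnhausTransform {R : Type*} [CommRing R] [IsDomain R] (f : R[X]) (a : Fin 9 → R) :
    R[X] :=
  (f.roots.map fun x => X - C (tschirnhausValue a x)).prod

/-- `AuxTower degs L`: the field `L` is obtained from the base field `F` by successively adjoining
one root each of finitely many auxiliary equations; every equation is nonzero with coefficients
in the field obtained so far, and `degs` lists the degrees (the last equation first). -/
inductive AuxTower {F Ω : Type*} [Field F] [Field Ω] [Algebra F Ω] :
    List ℕ → IntermediateField F Ω → Prop
  | base : AuxTower [] ⊥
  | step {degs : List ℕ} {E : IntermediateField F Ω} (p : E[X]) (θ : Ω)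
      (hE : AuxTower degs E) (hp : p ≠ 0) (hθ : aeval θ p = 0) :
      AuxTower (p.natDegree :: degs) (E ⊔ IntermediateField.adjoin F {θ})

end NinthDegree

end

open Polynomial

noncomputable section

/-! In `Ω ^ 9`, with one coordinate per root and `τ` the sum of coordinates, a Tschirnhaus
transformation over `M` is an element of `equivariantSubalgebra x M`. By Newton's identities it
suffices to find such a `y ≠ 0` with `τ (y ^ m) = 0` for `m = 1, 2, 3, 4`. Below, "rational" refers
to the field reached so far, closed under equations of degree at most four (`quarticClosure`).

The hyperplane `τ = 0` has dimension 8. It contains a rational `P` on the quadric `τ (z ^ 2) = 0`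
and the cubic `τ (z ^ 3) = 0`, and five independent directions, not spanning `P`, tangent to both at
`P` (`exists_tangent_frame`). If `z ≠ 0` in their span satisfies `τ (z ^ 2) = τ (P z ^ 2) = τ (z ^
3) = 0`, the whole line `Pz` lies on quadric and cubic, and a quartic equation gives the point of
that line with `τ (y ^ 4) = 0`.

To find `z`, the pencil of the two quadratic forms in five variables has a singular member; its
determinant is the quintic (`exists_singular_pencil`). A singular form vanishes on a 3-dimensional
space (`exists_isotropic_space`). There the other form is a conic with a rational point, hence
parametrized by quadratic polynomials, and the cubic becomes the sextic
(`exists_conicPoint_pow_three_eq_zero`).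

Invertibility comes from group theory. The Galois group of the general equation is the full
symmetric group, and equations of degree at most six cannot destroy elements of order seven
(`AuxTower.exists_mem_fixingSubgroup`). These make `y` constant or injective on the roots; a
constant `y` with zero sum vanishes, so `y` is injective and interpolation gives the inverse. -/

namespace NinthDegree

/-! ### Towers of auxiliary equations and closure under degree at most four -/

section Towers

variable {F Ω : Type*} [Field F] [Field Ω] [Algebra F Ω]

/-- `E'` is obtained from `E` by adjoining a root of a nonzero polynomial of degree `n` with
coefficients in `E`. -/
def AdjoinStep (n : ℕ) (E E' : IntermediateField F Ω) : Prop :=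
  ∃ (p : Polynomial Ω) (θ : Ω), (∀ i, p.coeff i ∈ E) ∧ p ≠ 0 ∧ p.natDegree = n ∧ p.IsRoot θ ∧
    E' = E ⊔ IntermediateField.adjoin F {θ}

theorem exists_map_eq_of_coeff_mem (E : IntermediateField F Ω) {p : Polynomial Ω}
    (hp : ∀ i, p.coeff i ∈ E) : ∃ q : E[X], q.map (algebraMap E Ω) = p := by
  have : p ∈ Polynomial.lifts (algebraMap E Ω) := by
    rw [Polynomial.lifts_iff_coeff_lifts]
    exact fun i => ⟨⟨p.coeff i, hp i⟩, rfl⟩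
  exact (Polynomial.mem_lifts p).1 this

theorem AuxTower.adjoinStep {degs : List ℕ} {n : ℕ} {E E' : IntermediateField F Ω}
    (hE : AuxTower degs E) (h : AdjoinStep n E E') : AuxTower (n :: degs) E' := by
  obtain ⟨p, θ, hp, hp0, rfl, hθ, rfl⟩ := h
  obtain ⟨q, rfl⟩ := exists_map_eq_of_coeff_mem E hp
  rw [natDegree_map]
  refine AuxTower.step q θ hE (fun h => hp0 (by simp [h])) ?_
  rwa [IsRoot, eval_map_algebraMap] at hθ

theorem AdjoinStep.le {n : ℕ} {E E' : IntermediateField F Ω} (h : AdjoinStep n E E') :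
    E ≤ E' := by
  obtain ⟨p, θ, -, -, -, -, rfl⟩ := h
  exact le_sup_left

theorem AdjoinStep.sup {n : ℕ} {E E' : IntermediateField F Ω} (h : AdjoinStep n E E')
    (G : IntermediateField F Ω) : AdjoinStep n (G ⊔ E) (G ⊔ E') := by
  obtain ⟨p, θ, hp, hp0, hn, hθ, rfl⟩ := h
  exact ⟨p, θ, fun i => (le_sup_right : E ≤ G ⊔ E) (hp i), hp0, hn, hθ, (sup_assoc _ _ _).symm⟩

/-- `E'` is obtained from `E` by an auxiliary equation of degree at most four. -/
def QuarticStep (E E' : IntermediateField F Ω) : Prop := ∃ n ≤ 4, AdjoinStep n E E'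

/-- `E'` is obtained from `E` by finitely many auxiliary equations of degree at most four. -/
def QuarticTower : IntermediateField F Ω → IntermediateField F Ω → Prop :=
  Relation.ReflTransGen QuarticStep

theorem QuarticTower.le {E E' : IntermediateField F Ω} (h : QuarticTower E E') : E ≤ E' := by
  induction h with
  | refl => exact le_rfl
  | tail _ h ih =>
    obtain ⟨n, -, h⟩ := h
    exact ih.trans h.le

theorem QuarticTower.sup {E E' : IntermediateField F Ω} (h : QuarticTower E E')
    (G : IntermediateField F Ω) : QuarticTower (G ⊔ E) (G ⊔ E') := by
  induction h with
  | refl => exact Relation.ReflTransGen.refl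
  | tail _ h ih =>
    obtain ⟨n, hn, h⟩ := h
    exact ih.tail ⟨n, hn, h.sup G⟩

theorem QuarticTower.sup_of_le {E E' G : IntermediateField F Ω} (h : QuarticTower E E')
    (hG : E ≤ G) : QuarticTower G (G ⊔ E') := by
  simpa [sup_eq_left.2 hG] using h.sup G

theorem QuarticTower.trans {E E' E'' : IntermediateField F Ω} (h : QuarticTower E E')
    (h' : QuarticTower E' E'') : QuarticTower E E'' :=
  Relation.ReflTransGen.trans h h'

theorem QuarticTower.auxTower {degs : List ℕ} {E E' : IntermediateField F Ω}
    (h : QuarticTower E E') (hE : AuxTower degs E) :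
    ∃ degs' : List ℕ, (∀ d ∈ degs', d ≤ 4) ∧ AuxTower (degs' ++ degs) E' := by
  induction h with
  | refl => exact ⟨[], by simp, hE⟩
  | tail _ h ih =>
    obtain ⟨degs', hd, hT⟩ := ih
    obtain ⟨n, hn, h⟩ := h
    exact ⟨n :: degs', by simpa using ⟨hn, hd⟩, hT.adjoinStep h⟩

/-- The union of all fields obtained from `E` by finitely many auxiliary equations of degree at
most four. -/
def quarticClosure (E : IntermediateField F Ω) : IntermediateField F Ω :=
  ⨆ G : {G : IntermediateField F Ω // QuarticTower E G}, G.1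

/-- The compositum of two quartic towers over `E` is again one, so the family is directed and its
supremum is a plain union. -/
theorem mem_quarticClosure {E : IntermediateField F Ω} {z : Ω} :
    z ∈ quarticClosure E ↔ ∃ G, QuarticTower E G ∧ z ∈ G := by
  have : Nonempty {G : IntermediateField F Ω // QuarticTower E G} :=
    ⟨⟨E, Relation.ReflTransGen.refl⟩⟩
  have hdir : Directed (· ≤ ·)
      (fun G : {G : IntermediateField F Ω // QuarticTower E G} => G.1) := fun G H =>
    ⟨⟨G.1 ⊔ H.1, G.2.trans (H.2.sup_of_le G.2.le)⟩, le_sup_left, le_sup_right⟩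
  rw [quarticClosure, ← SetLike.mem_coe, IntermediateField.coe_iSup_of_directed hdir]
  simp

theorem exists_quarticTower_of_finset {E : IntermediateField F Ω} (s : Finset Ω)
    (hs : ∀ z ∈ s, z ∈ quarticClosure E) : ∃ G, QuarticTower E G ∧ ∀ z ∈ s, z ∈ G := by
  classical
  induction s using Finset.induction_on with
  | empty => exact ⟨E, Relation.ReflTransGen.refl, by simp⟩
  | insert a s _ ih =>
    obtain ⟨G, hG, hs'⟩ := ih fun z hz => hs z (Finset.mem_insert_of_mem hz)
    obtain ⟨H, hH, ha⟩ := mem_quarticClosure.1 (hs a (Finset.mem_insert_self a s))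
    refine ⟨G ⊔ H, hG.trans (hH.sup_of_le hG.le), fun z hz => ?_⟩
    rcases Finset.mem_insert.1 hz with rfl | hz
    · exact (le_sup_right : H ≤ G ⊔ H) ha
    · exact (le_sup_left : G ≤ G ⊔ H) (hs' z hz)

theorem exists_quarticTower_of_coeff {E : IntermediateField F Ω} (p : Polynomial Ω)
    (hp : ∀ i, p.coeff i ∈ quarticClosure E) : ∃ G, QuarticTower E G ∧ ∀ i, p.coeff i ∈ G := by
  classical
  obtain ⟨G, hG, h⟩ := exists_quarticTower_of_finset (p.support.image p.coeff) (E := E)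
    (by simp only [Finset.mem_image]; rintro _ ⟨i, -, rfl⟩; exact hp i)
  refine ⟨G, hG, fun i => ?_⟩
  by_cases hi : p.coeff i = 0
  · rw [hi]; exact zero_mem G
  · exact h _ (Finset.mem_image_of_mem _ (mem_support_iff.2 hi))

theorem le_quarticClosure (E : IntermediateField F Ω) : E ≤ quarticClosure E :=
  fun _ hz => mem_quarticClosure.2 ⟨E, Relation.ReflTransGen.refl, hz⟩

theorem quarticClosure_mono {E G : IntermediateField F Ω} (h : E ≤ G) :
    quarticClosure E ≤ quarticClosure G := by
  intro z hz
  obtain ⟨H, hH, hz⟩ := mem_quarticClosure.1 hz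
  exact mem_quarticClosure.2 ⟨G ⊔ H, hH.sup_of_le h, (le_sup_right : H ≤ G ⊔ H) hz⟩

/-- `M` contains the roots of all polynomials of degree at most four with coefficients in `M`. -/
def QuarticClosed (M : IntermediateField F Ω) : Prop :=
  ∀ (p : Polynomial Ω) (θ : Ω), (∀ i, p.coeff i ∈ M) → p ≠ 0 → p.natDegree ≤ 4 → p.IsRoot θ → θ ∈ M

theorem quarticClosed_quarticClosure (E : IntermediateField F Ω) :
    QuarticClosed (quarticClosure E) := by
  intro p θ hp hp0 hn hθ
  obtain ⟨G, hG, hGp⟩ := exists_quarticTower_of_coeff p hp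
  exact mem_quarticClosure.2 ⟨G ⊔ IntermediateField.adjoin F {θ},
    hG.tail ⟨_, hn, p, θ, hGp, hp0, rfl, hθ, rfl⟩,
    (le_sup_right : _ ≤ G ⊔ IntermediateField.adjoin F {θ})
      (IntermediateField.mem_adjoin_simple_self F θ)⟩

/-- A root of one further polynomial over the quartic closure is contained in the quartic closure
of the field reached by one further auxiliary equation. -/
theorem exists_adjoinStep_quarticClosure {E : IntermediateField F Ω} (p : Polynomial Ω) (θ : Ω)
    (hp : ∀ i, p.coeff i ∈ quarticClosure E) (hp0 : p ≠ 0) (hθ : p.IsRoot θ) :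
    ∃ G G', QuarticTower E G ∧ AdjoinStep p.natDegree G G' ∧
      quarticClosure E ≤ quarticClosure G' ∧ θ ∈ quarticClosure G' := by
  obtain ⟨G, hG, hGp⟩ := exists_quarticTower_of_coeff p hp
  have hs : AdjoinStep p.natDegree G (G ⊔ IntermediateField.adjoin F {θ}) :=
    ⟨p, θ, hGp, hp0, rfl, hθ, rfl⟩
  exact ⟨G, _, hG, hs, quarticClosure_mono (hG.le.trans hs.le), le_quarticClosure _
    ((le_sup_right : _ ≤ G ⊔ IntermediateField.adjoin F {θ})
      (IntermediateField.mem_adjoin_simple_self F θ))⟩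

end Towers


/-! ### The Galois group of the general equation -/

section GenericGalois

/-- Through `ψ`, `Ω` is an algebraic closure of `R`, and automorphisms of the base extend to it. -/
theorem exists_ringEquiv_of_injective {R Ω : Type*} [CommRing R] [IsDomain R] [Field Ω]
    [IsAlgClosed Ω] (ψ : R →+* Ω) (hψ : Function.Injective ψ)
    (halg : ∀ z : Ω, ∃ p : R[X], p ≠ 0 ∧ p.eval₂ ψ z = 0) (e : R ≃+* R) :
    ∃ σ : Ω ≃+* Ω, ∀ p, σ (ψ p) = ψ (e p) := by
  let _ : Algebra R Ω := ψ.toAlgebra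
  have : FaithfulSMul R Ω := (faithfulSMul_iff_algebraMap_injective R Ω).2 hψ
  have : IsAlgClosure R Ω := ⟨inferInstance, ⟨fun z => halg z⟩⟩
  exact ⟨IsAlgClosure.equivOfEquiv Ω Ω e,
    fun p => IsAlgClosure.equivOfEquiv_algebraMap Ω Ω e p⟩

variable (K : Type*) [Field K]

theorem generalPoly_coeff (i : Fin 9) : (generalPoly K).coeff (8 - (i : ℕ)) =
    algebraMap (MvPolynomial (Fin 9) K) (CoeffField K) (MvPolynomial.X i) := by
  rw [generalPoly, coeff_add, finsetSum_coeff, coeff_X_pow, if_neg (by omega), zero_add,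
    Finset.sum_eq_single i]
  · simp
  · intro j _ hj
    rw [coeff_C_mul, coeff_X_pow, if_neg, mul_zero]
    intro h
    exact hj (Fin.ext (by omega))
  · simp

theorem generalPoly_degree_sum_lt : (∑ i : Fin 9,
    C (algebraMap (MvPolynomial (Fin 9) K) (CoeffField K) (MvPolynomial.X i)) *
      X ^ (8 - (i : ℕ))).degree < ((9 : ℕ) : WithBot ℕ) := by
  refine (degree_sum_le _ _).trans_lt ?_
  rw [Finset.sup_lt_iff (WithBot.bot_lt_coe 9)]
  intro i _
  refine (degree_C_mul_X_pow_le _ _).trans_lt ?_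
  exact_mod_cast (by omega : 8 - (i : ℕ) < 9)

theorem generalPoly_monic : (generalPoly K).Monic :=
  monic_X_pow_add (generalPoly_degree_sum_lt K)

theorem generalPoly_natDegree : (generalPoly K).natDegree = 9 := by
  rw [generalPoly]
  refine natDegree_eq_of_degree_eq_some ?_
  rw [degree_add_eq_left_of_degree_lt, degree_X_pow]
  rw [degree_X_pow]
  exact generalPoly_degree_sum_lt K

theorem exists_roots_generalPoly : ∃ x : Fin 9 → Closure K,
    (generalPoly K).map (algebraMap (CoeffField K) (Closure K)) = ∏ i, (X - C (x i)) := by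
  set f := (generalPoly K).map (algebraMap (CoeffField K) (Closure K)) with hf
  have hmonic : f.Monic := (generalPoly_monic K).map _
  have hsplit : f.Splits := IsAlgClosed.splits f
  have hcard : f.roots.card = 9 := by
    rw [← hsplit.natDegree_eq_card_roots, hf, natDegree_map, generalPoly_natDegree]
  obtain ⟨l, hl⟩ := Quot.exists_rep f.roots
  have hl' : (l : Multiset (Closure K)) = f.roots := hl
  have hlen : l.length = 9 := by rw [← Multiset.coe_card, hl', hcard]
  refine ⟨fun i => l.get (i.cast hlen.symm), ?_⟩
  rw [hsplit.eq_prod_roots_of_monic hmonic, ← hl', Multiset.map_coe, Multiset.prod_coe]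
  rw [← List.prod_ofFn]
  congr 1
  refine List.ext_get (by simp [hlen]) ?_
  intro n h1 h2
  simp only [List.get_eq_getElem, List.getElem_map, List.getElem_ofFn, Fin.cast]

/-- The polynomial whose roots are the nine indeterminates. -/
def indeterminateRootsPoly : (MvPolynomial (Fin 9) K)[X] := ∏ i, (X - C (MvPolynomial.X i))

/-- The homomorphism sending `c_i` to the corresponding coefficient of the polynomial whose roots
are the indeterminates. -/
def vietaHom : MvPolynomial (Fin 9) K →ₐ[K] MvPolynomial (Fin 9) K :=
  MvPolynomial.aeval fun i => (indeterminateRootsPoly K).coeff (8 - (i : ℕ))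

theorem indeterminateRootsPoly_natDegree : (indeterminateRootsPoly K).natDegree = 9 := by
  rw [indeterminateRootsPoly, natDegree_prod_of_monic _ _ fun _ _ => monic_X_sub_C _]
  simp

theorem indeterminateRootsPoly_monic : (indeterminateRootsPoly K).Monic :=
  monic_prod_of_monic _ _ fun _ _ => monic_X_sub_C _

/-- Each indeterminate is a root of `indeterminateRootsPoly K`, which is monic with coefficients in
the image of `vietaHom K`. -/
theorem vietaHom_isIntegral : (vietaHom K).toRingHom.IsIntegral := by
  have hX : ∀ i, (vietaHom K).toRingHom.IsIntegralElem (MvPolynomial.X i) := by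
    intro i
    have hl : indeterminateRootsPoly K ∈ lifts (vietaHom K).toRingHom := by
      rw [lifts_iff_coeff_lifts]
      intro n
      rcases lt_trichotomy n 9 with h | rfl | h
      · refine ⟨MvPolynomial.X ⟨8 - n, by omega⟩, ?_⟩
        simp only [vietaHom, AlgHom.toRingHom_eq_coe, RingHom.coe_coe, MvPolynomial.aeval_X]
        congr 1
        omega
      · refine ⟨1, ?_⟩
        have := indeterminateRootsPoly_monic K
        rw [Monic, leadingCoeff, indeterminateRootsPoly_natDegree] at this
        rw [this, map_one]
      · refine ⟨0, ?_⟩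
        rw [coeff_eq_zero_of_natDegree_lt (by rwa [indeterminateRootsPoly_natDegree]), map_zero]
    obtain ⟨q, hq, -, hqm⟩ := lifts_and_natDegree_eq_and_monic hl (indeterminateRootsPoly_monic K)
    refine ⟨q, hqm, ?_⟩
    rw [← eval_map, hq, indeterminateRootsPoly, eval_prod]
    exact Finset.prod_eq_zero (Finset.mem_univ i) (by simp)
  intro p
  induction p using MvPolynomial.induction_on with
  | C a =>
    refine ⟨X - C (MvPolynomial.C a), monic_X_sub_C _, ?_⟩
    have : vietaHom K (MvPolynomial.C a) = MvPolynomial.C a := (vietaHom K).commutes a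
    simp [this]
  | add p q hp hq => exact hp.add _ hq
  | mul_X p i hp => exact hp.mul _ (hX i)

theorem rename_vietaHom (π : Equiv.Perm (Fin 9)) (p : MvPolynomial (Fin 9) K) :
    MvPolynomial.rename π (vietaHom K p) = vietaHom K p := by
  have hπ : (indeterminateRootsPoly K).map
      (MvPolynomial.rename (R := K) π : _ →+* MvPolynomial (Fin 9) K) =
        indeterminateRootsPoly K := by
    simp only [indeterminateRootsPoly, Polynomial.map_prod, Polynomial.map_sub, map_X, map_C,
      RingHom.coe_coe, MvPolynomial.rename_X]
    exact Equiv.prod_comp π fun i => (X - C (MvPolynomial.X i) : (MvPolynomial (Fin 9) K)[X])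
  have : (MvPolynomial.rename π).comp (vietaHom K) = vietaHom K := by
    apply MvPolynomial.algHom_ext
    intro i
    simp only [vietaHom, AlgHom.comp_apply, MvPolynomial.aeval_X]
    conv_rhs => rw [← hπ]
    rw [coeff_map]
    rfl
  exact DFunLike.congr_fun this p

variable {K}

theorem aeval_vietaHom {x : Fin 9 → Closure K}
    (hx : (generalPoly K).map (algebraMap (CoeffField K) (Closure K)) = ∏ i, (X - C (x i)))
    (p : MvPolynomial (Fin 9) K) :
    MvPolynomial.aeval x (vietaHom K p) = algebraMap _ (Closure K) p := by
  have hm : (indeterminateRootsPoly K).map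
      (MvPolynomial.aeval (R := K) x : _ →+* Closure K) =
        (generalPoly K).map (algebraMap (CoeffField K) (Closure K)) := by
    rw [hx]
    simp [indeterminateRootsPoly, Polynomial.map_prod]
  have : (MvPolynomial.aeval x).comp (vietaHom K) =
      IsScalarTower.toAlgHom K (MvPolynomial (Fin 9) K) (Closure K) := by
    apply MvPolynomial.algHom_ext
    intro i
    simp only [vietaHom, AlgHom.comp_apply, MvPolynomial.aeval_X, IsScalarTower.coe_toAlgHom']
    have h := congrArg (fun q => q.coeff (8 - (i : ℕ))) hm
    simp only [coeff_map, generalPoly_coeff] at h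
    rw [IsScalarTower.algebraMap_apply _ (CoeffField K) (Closure K)]
    exact h
  exact DFunLike.congr_fun this p

theorem algebraMap_closure_injective :
    Function.Injective (algebraMap (MvPolynomial (Fin 9) K) (Closure K)) := by
  rw [IsScalarTower.algebraMap_eq _ (CoeffField K) (Closure K)]
  exact (algebraMap (CoeffField K) (Closure K)).injective.comp
    (IsFractionRing.injective (MvPolynomial (Fin 9) K) (CoeffField K))

/-- The roots are algebraically independent: by integrality, a relation between them would yield a
nonzero relation between the independent coefficients `c_i`. -/
theorem aeval_roots_injective {x : Fin 9 → Closure K}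
    (hx : (generalPoly K).map (algebraMap (CoeffField K) (Closure K)) = ∏ i, (X - C (x i))) :
    Function.Injective (MvPolynomial.aeval (R := K) x) := by
  rw [injective_iff_map_eq_zero]
  intro r hr
  by_contra hr0
  obtain ⟨p, hpm, hp⟩ := vietaHom_isIntegral K r
  obtain ⟨i, hi, hmem⟩ := Ideal.exists_coeff_ne_zero_mem_comap_of_root_mem
    (I := RingHom.ker (MvPolynomial.aeval (R := K) x)) hr0 hr hpm.ne_zero hp
  apply hi
  apply algebraMap_closure_injective
  rw [map_zero, ← aeval_vietaHom hx]
  exact hmem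

/-- Every permutation of the roots of the general equation is induced by an automorphism. -/
theorem exists_algEquiv_perm_roots {x : Fin 9 → Closure K}
    (hx : (generalPoly K).map (algebraMap (CoeffField K) (Closure K)) = ∏ i, (X - C (x i)))
    (π : Equiv.Perm (Fin 9)) :
    ∃ σ : Closure K ≃ₐ[CoeffField K] Closure K, ∀ i, σ (x i) = x (π i) := by
  have hinj := aeval_roots_injective hx
  have halg : ∀ z : Closure K, ∃ p : (MvPolynomial (Fin 9) K)[X], p ≠ 0 ∧
      p.eval₂ (MvPolynomial.aeval (R := K) x : MvPolynomial (Fin 9) K →ₐ[K] Closure K).toRingHom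
        z = 0 := by
    intro z
    have hz : IsAlgebraic (MvPolynomial (Fin 9) K) z :=
      (IsFractionRing.isAlgebraic_iff (MvPolynomial (Fin 9) K) (CoeffField K) (Closure K)).2
        (Algebra.IsAlgebraic.isAlgebraic z)
    obtain ⟨p, hp0, hp⟩ := hz
    have hcomp : (MvPolynomial.aeval (R := K) x).toRingHom.comp (vietaHom K).toRingHom =
        algebraMap (MvPolynomial (Fin 9) K) (Closure K) :=
      RingHom.ext fun q => aeval_vietaHom hx q
    -- An equation for `z` over `K[c]` becomes one over `K[x]` when each `c_i` is written as a
    -- polynomial in the roots.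
    refine ⟨p.map (vietaHom K).toRingHom, ?_, ?_⟩
    · rwa [Ne, Polynomial.map_eq_zero_iff]
      intro a b hab
      apply algebraMap_closure_injective
      rw [← hcomp, RingHom.comp_apply, hab, RingHom.comp_apply]
    · rw [eval₂_map, hcomp]
      exact hp
  obtain ⟨σ, hσ⟩ : ∃ σ : Closure K ≃+* Closure K, ∀ p : MvPolynomial (Fin 9) K,
      σ (MvPolynomial.aeval x p) = MvPolynomial.aeval x (MvPolynomial.rename π p) := by
    exact exists_ringEquiv_of_injective _ hinj halg (MvPolynomial.renameEquiv K π).toRingEquiv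
  -- The coefficients are symmetric in the roots, hence fixed by `σ`.
  have hfix : (σ : Closure K →+* Closure K).comp (algebraMap (CoeffField K) (Closure K)) =
      algebraMap (CoeffField K) (Closure K) := by
    apply IsLocalization.ringHom_ext (nonZeroDivisors (MvPolynomial (Fin 9) K))
    refine RingHom.ext fun p => ?_
    have h := hσ (vietaHom K p)
    rw [rename_vietaHom, aeval_vietaHom hx] at h
    simpa only [RingHom.comp_apply, RingHom.coe_coe, ← IsScalarTower.algebraMap_apply] using h
  refine ⟨AlgEquiv.ofRingEquiv (f := σ) fun a => RingHom.congr_fun hfix a, fun i => ?_⟩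
  have := hσ (MvPolynomial.X i)
  exact (by simpa using this : σ (x i) = x (π i))

theorem roots_injective {x : Fin 9 → Closure K}
    (hx : (generalPoly K).map (algebraMap (CoeffField K) (Closure K)) = ∏ i, (X - C (x i))) :
    Function.Injective x := by
  intro i j hij
  have h := aeval_roots_injective hx
    (a₁ := MvPolynomial.X i) (a₂ := MvPolynomial.X j) (by simpa using hij)
  exact MvPolynomial.X_injective h

end GenericGalois


/-! ### Survival of permutations of order seven -/

section SevenCycles

variable {F Ω : Type*} [Field F] [Field Ω] [Algebra F Ω]

/-- Pigeonhole: the seven elements `(σ ^ i) θ` with `i < 7` lie among at most six roots. -/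
theorem exists_pow_fixes_root {θ : Ω} {p : Polynomial Ω} (hp : p ≠ 0) (hn : p.natDegree ≤ 6)
    (σ : Ω ≃ₐ[F] Ω) (hσ : ∀ i : ℕ, p.IsRoot ((σ ^ i) θ)) :
    ∃ m, 1 ≤ m ∧ m ≤ 6 ∧ (σ ^ m) θ = θ := by
  classical
  have hcard : p.roots.toFinset.card < (Finset.range 7).card := by
    rw [Finset.card_range]
    exact ((Multiset.toFinset_card_le _).trans (card_roots' p)).trans_lt (by omega)
  obtain ⟨i, hi, j, hj, hij, h⟩ := Finset.exists_ne_map_eq_of_card_lt_of_maps_to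
    (f := fun i => (σ ^ i) θ) hcard fun i _ => by simpa [hp] using hσ i
  simp only [Finset.mem_range] at hi hj h
  have key : ∀ i j : ℕ, i < j → (σ ^ i) θ = (σ ^ j) θ → (σ ^ (j - i)) θ = θ := by
    intro i j hij h
    apply (σ ^ i).injective
    rw [← AlgEquiv.mul_apply, ← pow_add, Nat.add_sub_cancel' hij.le, h]
  rcases lt_or_gt_of_ne hij with hlt | hlt
  · exact ⟨j - i, by omega, by omega, key i j hlt h⟩
  · exact ⟨i - j, by omega, by omega, key j i hlt h.symm⟩

theorem pow_apply_of_forall_apply {ι : Type*} {x : ι → Ω} {σ : Ω ≃ₐ[F] Ω} {π : Equiv.Perm ι}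
    (h : ∀ i, σ (x i) = x (π i)) (n : ℕ) (i : ι) : (σ ^ n) (x i) = x ((π ^ n) i) := by
  induction n generalizing i with
  | zero => simp
  | succ n ih => rw [pow_succ, AlgEquiv.mul_apply, h, ih, pow_succ, Equiv.Perm.mul_apply]

/-- Auxiliary equations of degree at most six do not destroy the automorphisms inducing
permutations of order seven. -/
theorem AuxTower.exists_mem_fixingSubgroup {ι : Type*} {x : ι → Ω}
    (hx : ∀ π : Equiv.Perm ι, ∃ σ : Ω ≃ₐ[F] Ω, ∀ i, σ (x i) = x (π i))
    {degs : List ℕ} {L : IntermediateField F Ω} (hL : AuxTower degs L)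
    (hdegs : ∀ d ∈ degs, d ≤ 6) (π : Equiv.Perm ι) (hπ : π ^ 7 = 1) :
    ∃ σ ∈ L.fixingSubgroup, ∀ i, σ (x i) = x (π i) := by
  induction hL with
  | base =>
    obtain ⟨σ, hσ⟩ := hx π
    exact ⟨σ, by simp [IntermediateField.fixingSubgroup_bot], hσ⟩
  | @step degs E p θ hE hp hθ ih =>
    obtain ⟨σ, hσE, hσ⟩ := ih fun d hd => hdegs d (List.mem_cons_of_mem _ hd)
    have hpow : ∀ n : ℕ, ∀ z ∈ E, (σ ^ n) z = z := fun n z hz =>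
      (IntermediateField.mem_fixingSubgroup_iff E _).1 (E.fixingSubgroup.pow_mem hσE n) z hz
    have hroot : ∀ i : ℕ, (p.map (algebraMap E Ω)).IsRoot ((σ ^ i) θ) := by
      intro i
      have hcomp : ((σ ^ i : Ω ≃ₐ[F] Ω) : Ω →+* Ω).comp (algebraMap E Ω) = algebraMap E Ω :=
        RingHom.ext fun z => hpow i z z.2
      have h := congrArg (σ ^ i) hθ
      rw [map_zero, aeval_def] at h
      rw [IsRoot, eval_map, ← h]
      conv_lhs => rw [← hcomp]
      exact (hom_eval₂ p (algebraMap E Ω) ((σ ^ i : Ω ≃ₐ[F] Ω) : Ω →+* Ω) θ).symm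
    obtain ⟨m, hm1, hm6, hm⟩ := exists_pow_fixes_root (p := p.map (algebraMap E Ω))
      ((Polynomial.map_ne_zero_iff (algebraMap E Ω).injective).2 hp)
      (by rw [natDegree_map]; exact hdegs _ List.mem_cons_self) σ hroot
    -- Since `m` is prime to 7, take for `k` its inverse modulo 7; then `σ ^ (m * k)` fixes `θ` and
    -- still induces `π`.
    obtain ⟨k, hk⟩ : ∃ k, π ^ (m * k) = π := by
      have h7 : ∀ a : ℕ, π ^ (7 * a + 1) = π := fun a => by
        rw [pow_succ, pow_mul, hπ, one_pow, one_mul]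
      interval_cases m
      exacts [⟨1, h7 0⟩, ⟨4, h7 1⟩, ⟨5, h7 2⟩, ⟨2, h7 1⟩, ⟨3, h7 2⟩, ⟨6, h7 5⟩]
    refine ⟨σ ^ (m * k), ?_, fun i => by rw [pow_apply_of_forall_apply hσ, hk]⟩
    rw [IntermediateField.fixingSubgroup_sup]
    refine ⟨E.fixingSubgroup.pow_mem hσE _, ?_⟩
    have hle : Subgroup.zpowers (σ ^ m) ≤
        (IntermediateField.adjoin F {θ}).fixingSubgroup := by
      rw [← IntermediateField.le_iff_le, IntermediateField.adjoin_simple_le_iff,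
        IntermediateField.mem_fixedField_iff]
      intro f hf
      have : Subgroup.zpowers (σ ^ m) ≤ MulAction.stabilizer (Ω ≃ₐ[F] Ω) θ := by
        rw [Subgroup.zpowers_le]
        exact hm
      exact this hf
    rw [pow_mul]
    exact hle (Subgroup.pow_mem _ (Subgroup.mem_zpowers _) k)

/-- A permutation of order seven fixing one given point and moving a second given point to a
third one. -/
theorem exists_perm_pow_seven {i j k : Fin 9} (hij : j ≠ i) (hik : k ≠ i) (hjk : j ≠ k) :
    ∃ π : Equiv.Perm (Fin 9), π ^ 7 = 1 ∧ π i = i ∧ π j = k := by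
  set c : Equiv.Perm (Fin 9) := List.formPerm [0, 1, 2, 3, 4, 5, 6]
  have hc : c ^ 7 = 1 := List.formPerm_pow_length_eq_one_of_nodup [0, 1, 2, 3, 4, 5, 6] (by decide)
  have hc7 : c 7 = 7 := by decide
  have hc0 : c 0 = 1 := by decide
  obtain ⟨τ, h7, h0, h1⟩ : ∃ τ : Equiv.Perm (Fin 9), τ 7 = i ∧ τ 0 = j ∧ τ 1 = k := by
    have hinj : Function.Injective ![i, j, k] := by
      intro a b hab
      fin_cases a <;> fin_cases b <;> simp_all
    have hinj' : Function.Injective ![(7 : Fin 9), 0, 1] := by decide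
    obtain ⟨τ, h⟩ := Equiv.Perm.exists_extending_pair _ _ hinj' hinj
    exact ⟨τ, h 0, h 1, h 2⟩
  -- The cycle `c` fixes 7 and sends 0 to 1, so its conjugate fixes `i` and sends `j` to `k`.
  refine ⟨τ * c * τ⁻¹, ?_, ?_, ?_⟩
  · rw [conj_pow, hc]; simp
  · simp [← h7, hc7]
  · simp [← h1, ← h0, hc0]

/-- A family of values attached to the roots which is compatible with the automorphisms over `L`
is either constant or injective. -/
theorem AuxTower.injective_of_ne {x : Fin 9 → Ω}
    (hx : ∀ π : Equiv.Perm (Fin 9), ∃ σ : Ω ≃ₐ[F] Ω, ∀ i, σ (x i) = x (π i))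
    {degs : List ℕ} {L : IntermediateField F Ω} (hL : AuxTower degs L)
    (hdegs : ∀ d ∈ degs, d ≤ 6) {y : Fin 9 → Ω}
    (hy : ∀ σ ∈ L.fixingSubgroup, ∀ i j, σ (x i) = x j → σ (y i) = y j)
    (hne : ∃ i j, y i ≠ y j) : Function.Injective y := by
  intro i j hij
  by_contra hij'
  obtain ⟨a, b, hab⟩ := hne
  have hall : ∀ k, y k = y i := by
    intro k
    by_cases hki : k = i
    · rw [hki]
    by_cases hjk : j = k
    · rw [← hjk, hij]
    -- The resulting automorphism sends `y i` to itself and `y j` to `y k`; as `y i = y j`, also `y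
    -- k = y i`.
    obtain ⟨π, hπ, hπi, hπj⟩ := exists_perm_pow_seven (Ne.symm hij') hki hjk
    obtain ⟨σ, hσL, hσ⟩ := hL.exists_mem_fixingSubgroup hx hdegs π hπ
    have h1 := hy σ hσL i i (by rw [hσ, hπi])
    have h2 := hy σ hσL j k (by rw [hσ, hπj])
    rw [← h1, ← h2, hij]
  exact hab (by rw [hall a, hall b])

end SevenCycles


/-! ### Equivariant families and interpolation -/

section Equivariant

variable {F Ω : Type*} [Field F] [Field Ω] [Algebra F Ω]

/-- The families of values attached to the points `x i` which are compatible with all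
automorphisms over `M`. -/
def equivariantSubalgebra (x : Fin 9 → Ω) (M : IntermediateField F Ω) :
    Subalgebra M (Fin 9 → Ω) where
  carrier := {v | ∀ σ ∈ M.fixingSubgroup, ∀ i j, σ (x i) = x j → σ (v i) = v j}
  mul_mem' hv hw σ hσ i j h := by
    rw [Pi.mul_apply, map_mul, hv σ hσ i j h, hw σ hσ i j h, Pi.mul_apply]
  add_mem' hv hw σ hσ i j h := by
    rw [Pi.add_apply, map_add, hv σ hσ i j h, hw σ hσ i j h, Pi.add_apply]
  algebraMap_mem' m σ hσ i j _ := (IntermediateField.mem_fixingSubgroup_iff M σ).1 hσ m m.2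

variable {x : Fin 9 → Ω}

theorem equivariantSubalgebra_mono {M M' : IntermediateField F Ω} (h : M ≤ M')
    {v : Fin 9 → Ω} (hv : v ∈ equivariantSubalgebra x M) : v ∈ equivariantSubalgebra x M' :=
  fun σ hσ => hv σ (IntermediateField.fixingSubgroup_antitone h hσ)

theorem self_mem_equivariantSubalgebra (M : IntermediateField F Ω) :
    x ∈ equivariantSubalgebra x M := fun _ _ _ _ h => h

theorem mem_of_forall_fixingSubgroup [IsGalois F Ω] {M : IntermediateField F Ω} {z : Ω}
    (h : ∀ σ ∈ M.fixingSubgroup, σ z = z) : z ∈ M := by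
  rw [← InfiniteGalois.fixedField_fixingSubgroup M]
  exact (IntermediateField.mem_fixedField_iff _ _).2 h

theorem tschirnhausValue_eq_eval {R : Type*} [CommRing R] {p : R[X]} (hp : p.degree < 9)
    (z : R) : tschirnhausValue (fun j => p.coeff j) z = p.eval z := by
  rw [tschirnhausValue, Fin.sum_univ_eq_sum_range (fun j => p.coeff j * z ^ j)]
  refine (eval_eq_sum_range' ?_ z).symm
  by_cases h0 : p = 0
  · simp [h0]
  · exact (natDegree_lt_iff_degree_lt h0).2 hp

variable [IsGalois F Ω] (hperm : ∀ σ : Ω ≃ₐ[F] Ω, ∃ π : Equiv.Perm (Fin 9), ∀ i, σ (x i) = x (π i))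
include hperm

theorem sum_mem_of_mem_equivariantSubalgebra {M : IntermediateField F Ω} {v : Fin 9 → Ω}
    (hv : v ∈ equivariantSubalgebra x M) : ∑ i, v i ∈ M := by
  refine mem_of_forall_fixingSubgroup fun σ hσ => ?_
  obtain ⟨π, hπ⟩ := hperm σ
  rw [map_sum]
  simp_rw [fun i => hv σ hσ i (π i) (hπ i)]
  exact Equiv.sum_comp π v

theorem coeff_prod_mem_of_mem_equivariantSubalgebra {M : IntermediateField F Ω} {v : Fin 9 → Ω}
    (hv : v ∈ equivariantSubalgebra x M) (n : ℕ) : (∏ i, (X - C (v i))).coeff n ∈ M := by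
  refine mem_of_forall_fixingSubgroup fun σ hσ => ?_
  obtain ⟨π, hπ⟩ := hperm σ
  have : (∏ i, (X - C (v i))).map (σ : Ω →+* Ω) = ∏ i, (X - C (v i)) := by
    simp only [Polynomial.map_prod, Polynomial.map_sub, map_X, map_C, RingHom.coe_coe]
    simp_rw [fun i => hv σ hσ i (π i) (hπ i)]
    exact Equiv.prod_comp π fun i => X - C (v i)
  conv_rhs => rw [← this]
  rw [coeff_map]
  rfl

/-- An automorphism over `M` only permutes the interpolation data, so by uniqueness it fixes the
Lagrange polynomial, whose coefficients then lie in `M`. With `u = x` this produces the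
transformation, with `v = x` its inverse. -/
theorem exists_tschirnhausValue_eq {M : IntermediateField F Ω} {u v : Fin 9 → Ω}
    (hu : u ∈ equivariantSubalgebra x M) (hv : v ∈ equivariantSubalgebra x M)
    (hinj : Function.Injective u) :
    ∃ b : Fin 9 → Ω, (∀ j, b j ∈ M) ∧ ∀ k, tschirnhausValue b (u k) = v k := by
  set p := Lagrange.interpolate Finset.univ u v with hp
  have hdeg : p.degree < 9 := Lagrange.degree_interpolate_lt v hinj.injOn
  have hev : ∀ k, p.eval (u k) = v k := fun k =>
    Lagrange.eval_interpolate_at_node v hinj.injOn (Finset.mem_univ k)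
  refine ⟨fun j => p.coeff j, fun j => ?_, fun k => by rw [tschirnhausValue_eq_eval hdeg, hev]⟩
  refine mem_of_forall_fixingSubgroup fun σ hσ => ?_
  obtain ⟨π, hπ⟩ := hperm σ
  have : p.map (σ : Ω →+* Ω) = p := by
    refine Lagrange.eq_interpolate_of_eval_eq v hinj.injOn (degree_map_le.trans_lt hdeg) ?_
    intro k _
    obtain ⟨i, rfl⟩ := π.surjective k
    rw [← hu σ hσ i (π i) (hπ i), ← hv σ hσ i (π i) (hπ i), ← hev i]
    exact eval_map_apply (σ : Ω →+* Ω) (u i)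
  change σ (p.coeff j) = p.coeff j
  conv_rhs => rw [← this]
  rw [coeff_map]
  rfl

end Equivariant


/-! ### Rational zeros of forms and isotropic planes -/

section LinearAlgebra

variable {k V : Type*} [Field k] [AddCommGroup V] [Module k V]

theorem linearMap_eq_zero_of_mem_span {W ι : Type*} [AddCommGroup W] [Module k W]
    {τ : V →ₗ[k] W} {v : ι → V} (h : ∀ i, τ (v i) = 0) {z : V}
    (hz : z ∈ Submodule.span k (Set.range v)) : τ z = 0 := by
  have : Submodule.span k (Set.range v) ≤ LinearMap.ker τ := by
    rw [Submodule.span_le]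
    rintro _ ⟨i, rfl⟩
    exact h i
  exact this hz

/-- Omit a basis vector that occurs in `e` with nonzero coefficient. This supplies a complement to a
point already found, so later points are independent of it. -/
theorem exists_notMem_span_succAbove {n : ℕ} {v : Fin (n + 1) → V} (hv : LinearIndependent k v)
    {e : V} (he : e ≠ 0) (hev : e ∈ Submodule.span k (Set.range v)) :
    ∃ j : Fin (n + 1), e ∉ Submodule.span k (Set.range (v ∘ j.succAbove)) := by
  obtain ⟨c, rfl⟩ := (Submodule.mem_span_range_iff_exists_fun k).1 hev
  obtain ⟨j, hj⟩ : ∃ j, c j ≠ 0 := by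
    by_contra! h
    exact he (by simp [h])
  refine ⟨j, fun hmem => ?_⟩
  obtain ⟨d, hd⟩ := (Submodule.mem_span_range_iff_exists_fun k).1 hmem
  have h := Fintype.linearIndependent_iff.1 hv (j.insertNth (c j) fun i => c (j.succAbove i) - d i)
    (by
      rw [Fin.sum_univ_succAbove _ j] at hd ⊢
      simp only [Fin.insertNth_apply_same, Fin.insertNth_apply_succAbove, sub_smul,
        Finset.sum_sub_distrib]
      simp only [Function.comp_apply] at hd
      rw [hd]
      abel) j
  rw [Fin.insertNth_apply_same] at h
  exact hj h

variable {F Ω B : Type*} [Field F] [Field Ω] [Algebra F Ω] [CommRing B] [Algebra Ω B]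

theorem mul_eq_zero_of_mem_span {ι : Type*} {τ : B →ₗ[Ω] Ω} {v : ι → B}
    (h : ∀ i j, τ (v i * v j) = 0) {y z : B} (hy : y ∈ Submodule.span Ω (Set.range v))
    (hz : z ∈ Submodule.span Ω (Set.range v)) : τ (y * z) = 0 := by
  refine linearMap_eq_zero_of_mem_span (τ := τ ∘ₗ LinearMap.mulLeft Ω y) (fun j => ?_) hz
  change τ (y * v j) = 0
  rw [mul_comm]
  refine linearMap_eq_zero_of_mem_span (τ := τ ∘ₗ LinearMap.mulLeft Ω (v j)) (fun i => ?_) hy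
  exact h j i

/-- A linear functional applied to the coefficients of a polynomial. -/
theorem exists_polynomial_coeff_eq (τ : B →ₗ[Ω] Ω) (Z : B[X]) :
    ∃ p : Polynomial Ω, (∀ i, p.coeff i = τ (Z.coeff i)) ∧
      ∀ t, p.eval t = τ (Z.eval (algebraMap Ω B t)) := by
  refine ⟨∑ i ∈ Finset.range (Z.natDegree + 1), C (τ (Z.coeff i)) * X ^ i, fun i => ?_,
    fun t => ?_⟩
  · simp only [finsetSum_coeff, coeff_C_mul, coeff_X_pow, mul_ite, mul_one, mul_zero,
      Finset.sum_ite_eq, Finset.mem_range]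
    split_ifs with h
    · rfl
    · rw [coeff_eq_zero_of_natDegree_lt (by omega), map_zero]
  · rw [eval_finsetSum, eval_eq_sum_range, map_sum]
    refine Finset.sum_congr rfl fun i _ => ?_
    rw [eval_mul, eval_C, eval_pow, eval_X, ← map_pow, mul_comm (Z.coeff i), ← Algebra.smul_def,
      map_smul, smul_eq_mul, mul_comm]

theorem natDegree_le_of_coeff_eq {τ : B →ₗ[Ω] Ω} {Z : B[X]} {p : Polynomial Ω}
    (hp : ∀ i, p.coeff i = τ (Z.coeff i)) {n : ℕ} (hn : Z.natDegree ≤ n) : p.natDegree ≤ n := by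
  rw [natDegree_le_iff_coeff_eq_zero] at hn ⊢
  intro i hi
  rw [hp, hn i hi, map_zero]

/-- The nonzero top coefficient makes the degree exactly `n`, so there is a root, and
`QuarticClosed` places it in `M`. -/
theorem exists_mem_eval_eq_zero [IsAlgClosed Ω] {M : IntermediateField F Ω}
    (hM : QuarticClosed M) {τ : B →ₗ[Ω] Ω}
    {Z : B[X]} (hZ : ∀ i, τ (Z.coeff i) ∈ M) {n : ℕ} (hn0 : n ≠ 0) (hn4 : n ≤ 4)
    (hn : Z.natDegree ≤ n) (hτn : τ (Z.coeff n) ≠ 0) :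
    ∃ t ∈ M, τ (Z.eval (algebraMap Ω B t)) = 0 := by
  obtain ⟨p, hp, hpe⟩ := exists_polynomial_coeff_eq τ Z
  have hdeg := natDegree_le_of_coeff_eq hp hn
  have hpn : p.coeff n ≠ 0 := by rwa [hp]
  have hdeg' : p.natDegree = n := le_antisymm hdeg (le_natDegree_of_ne_zero hpn)
  have hp0 : p ≠ 0 := fun h => hpn (by simp [h])
  obtain ⟨t, ht⟩ := IsAlgClosed.exists_root p (by
    rw [degree_eq_natDegree hp0, hdeg']
    exact_mod_cast hn0)
  exact ⟨t, hM p t (fun i => hp i ▸ hZ i) hp0 (hdeg.trans hn4) ht, hpe t ▸ ht⟩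

variable {M : IntermediateField F Ω} {A : Subalgebra M B}

theorem smul_mem_of_mem {c : Ω} (hc : c ∈ M) {v : B} (hv : v ∈ A) : c • v ∈ A :=
  A.smul_mem hv (⟨c, hc⟩ : M)

/-- In the kernel of a rational functional on the span of `n + 1` independent rational vectors
there are `n` independent rational vectors. -/
theorem exists_linearIndependent_ker {n : ℕ} {v : Fin (n + 1) → B} (hv : LinearIndependent Ω v)
    (hvA : ∀ i, v i ∈ A) {τ : B →ₗ[Ω] Ω} (hτ : ∀ z ∈ A, τ z ∈ M) :
    ∃ w : Fin n → B, LinearIndependent Ω w ∧ (∀ i, w i ∈ A) ∧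
      (∀ i, w i ∈ Submodule.span Ω (Set.range v)) ∧ ∀ i, τ (w i) = 0 := by
  by_cases h : ∀ j, τ (v j) = 0
  · exact ⟨v ∘ Fin.succ, hv.comp _ (Fin.succ_injective n), fun i => hvA _,
      fun i => Submodule.subset_span ⟨_, rfl⟩, fun i => h _⟩
  · push Not at h
    obtain ⟨j, hj⟩ := h
    -- Eliminate with the pivot `v j`, on which the functional does not vanish.
    refine ⟨fun i => v (j.succAbove i) - (τ (v (j.succAbove i)) / τ (v j)) • v j, ?_,
      fun i => sub_mem (hvA _)
        (smul_mem_of_mem (div_mem (hτ _ (hvA _)) (hτ _ (hvA _))) (hvA j)),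
      fun i => sub_mem (Submodule.subset_span ⟨_, rfl⟩)
        (Submodule.smul_mem _ _ (Submodule.subset_span ⟨_, rfl⟩)), fun i => ?_⟩
    · rw [Fintype.linearIndependent_iff]
      intro g hg i
      have := Fintype.linearIndependent_iff.1 hv
        (j.insertNth (-∑ i, g i * (τ (v (j.succAbove i)) / τ (v j))) g)
        (by
          rw [Fin.sum_univ_succAbove _ j]
          simp only [Fin.insertNth_apply_same, Fin.insertNth_apply_succAbove]
          simp only [smul_sub, smul_smul, Finset.sum_sub_distrib, ← Finset.sum_smul] at hg
          rw [neg_smul, neg_add_eq_sub]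
          exact hg) (j.succAbove i)
      rwa [Fin.insertNth_apply_succAbove] at this
    · rw [map_sub, map_smul, smul_eq_mul, div_mul_cancel₀ _ hj, sub_self]

variable [IsAlgClosed Ω]

/-- A binary form of degree at most four has a nontrivial rational zero. -/
theorem exists_pow_eq_zero (hM : QuarticClosed M) {τ : B →ₗ[Ω] Ω} (hτ : ∀ z ∈ A, τ z ∈ M)
    {v : Fin 2 → B} (hv : LinearIndependent Ω v) (hvA : ∀ i, v i ∈ A) {m : ℕ} (hm0 : m ≠ 0)
    (hm4 : m ≤ 4) :
    ∃ e ∈ A, e ≠ 0 ∧ e ∈ Submodule.span Ω (Set.range v) ∧ τ (e ^ m) = 0 := by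
  -- Here `v 1` is the point at infinity of the line `v 0 + t • v 1`; if it is no zero, the form has
  -- degree exactly `m` in `t`.
  by_cases h : τ (v 1 ^ m) = 0
  · exact ⟨v 1, hvA 1, hv.ne_zero 1, Submodule.subset_span ⟨1, rfl⟩, h⟩
  set Y : B[X] := C (v 1) * X + C (v 0) with hY
  have hYdeg : Y.natDegree ≤ 1 := natDegree_linear_le
  obtain ⟨t, ht, hτt⟩ := exists_mem_eval_eq_zero hM (τ := τ) (Z := Y ^ m) (n := m)
    (fun i => by
      have hmem : Y ∈ lifts (A.val : A →+* B) := by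
        rw [hY]
        exact add_mem (mul_mem (C'_mem_lifts (f := (A.val : A →+* B)) ⟨⟨v 1, hvA 1⟩, rfl⟩)
          (X_mem_lifts _)) (C'_mem_lifts ⟨⟨v 0, hvA 0⟩, rfl⟩)
      obtain ⟨a, ha⟩ := (lifts_iff_coeff_lifts _).1 (pow_mem hmem m) i
      exact hτ _ (ha ▸ a.2))
    hm0 hm4 (natDegree_pow_le_of_le m hYdeg |>.trans (by omega))
    (by
      have := coeff_pow_of_natDegree_le (m := m) hYdeg
      rw [mul_one] at this
      rw [this]
      simpa [hY] using h)
  refine ⟨t • v 1 + v 0, add_mem (smul_mem_of_mem ht (hvA 1)) (hvA 0), fun h0 => ?_,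
    add_mem (Submodule.smul_mem _ _ (Submodule.subset_span ⟨1, rfl⟩))
      (Submodule.subset_span ⟨0, rfl⟩), ?_⟩
  · have := Fintype.linearIndependent_iff.1 hv ![1, t] (by simpa [add_comm] using h0) 0
    simp at this
  · rwa [hY, eval_pow, eval_add, eval_mul, eval_C, eval_X, eval_C, mul_comm,
      ← Algebra.smul_def] at hτt

/-- A quadratic form in four variables vanishes on a rational plane. -/
theorem exists_isotropic_plane (hM : QuarticClosed M) {τ : B →ₗ[Ω] Ω} (hτ : ∀ z ∈ A, τ z ∈ M)
    {v : Fin 4 → B} (hv : LinearIndependent Ω v) (hvA : ∀ i, v i ∈ A) :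
    ∃ u : Fin 2 → B, LinearIndependent Ω u ∧ (∀ i, u i ∈ A) ∧
      (∀ i, u i ∈ Submodule.span Ω (Set.range v)) ∧ ∀ i j, τ (u i * u j) = 0 := by
  obtain ⟨e, heA, he0, hev, he⟩ := exists_pow_eq_zero hM hτ
    (v := v ∘ Fin.castLE (by norm_num : 2 ≤ 4)) (hv.comp _ (Fin.castLE_injective _))
    (fun i => hvA _) (m := 2) (by norm_num) (by norm_num)
  have hev' : e ∈ Submodule.span Ω (Set.range v) :=
    Submodule.span_mono (Set.range_comp_subset_range _ _) hev
  obtain ⟨j, hj⟩ := exists_notMem_span_succAbove hv he0 hev'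
  -- Inside a 3-dimensional complement of `e`, the vectors orthogonal to `e` contain a plane; an
  -- isotropic `f` in it completes `e`.
  obtain ⟨w, hw, hwA, hwv, hwτ⟩ := exists_linearIndependent_ker (A := A) (n := 2)
    (hv.comp _ Fin.succAbove_right_injective) (fun i => hvA (j.succAbove i))
    (τ := τ ∘ₗ LinearMap.mulLeft Ω e) (fun z hz => hτ _ (mul_mem heA hz))
  obtain ⟨f, hfA, hf0, hfw, hf⟩ := exists_pow_eq_zero hM hτ hw hwA (m := 2) (by norm_num)
    (by norm_num)
  have hfv : f ∈ Submodule.span Ω (Set.range (v ∘ j.succAbove)) :=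
    Submodule.span_le.2 (by rintro _ ⟨i, rfl⟩; exact hwv i) hfw
  have hef : τ (e * f) = 0 :=
    linearMap_eq_zero_of_mem_span (τ := τ ∘ₗ LinearMap.mulLeft Ω e) hwτ hfw
  refine ⟨![e, f], ?_, ?_, ?_, ?_⟩
  · rw [LinearIndependent.pair_iff' he0]
    intro a ha
    have ha0 : a ≠ 0 := fun h => hf0 (by rw [← ha, h, zero_smul])
    rw [← ha, Submodule.smul_mem_iff _ ha0] at hfv
    exact hj hfv
  · simpa [Fin.forall_fin_two] using ⟨heA, hfA⟩
  · simpa [Fin.forall_fin_two] using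
      ⟨hev', Submodule.span_mono (Set.range_comp_subset_range _ _) hfv⟩
  · simp only [Fin.forall_fin_two, Matrix.cons_val_zero, Matrix.cons_val_one]
    exact ⟨⟨by rwa [← pow_two], hef⟩, by rwa [mul_comm], by rwa [← pow_two]⟩

end LinearAlgebra


/-! ### Singular members of a pencil of matrices -/

section Pencil

variable {F Ω : Type*} [Field F] [Field Ω] [Algebra F Ω] {n : ℕ}

/-- The determinant already vanishes in `M`, so the kernel vector can be found over `M`. -/
theorem exists_mulVec_eq_zero_of_mem {M : IntermediateField F Ω} {N : Matrix (Fin n) (Fin n) Ω}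
    (hN : ∀ i j, N i j ∈ M) (hdet : N.det = 0) :
    ∃ d : Fin n → Ω, d ≠ 0 ∧ (∀ i, d i ∈ M) ∧ N.mulVec d = 0 := by
  set N' : Matrix (Fin n) (Fin n) M := Matrix.of fun i j => ⟨N i j, hN i j⟩
  have hN' : (algebraMap M Ω).mapMatrix N' = N := rfl
  have hdet' : N'.det = 0 := by
    apply (algebraMap M Ω).injective
    rw [RingHom.map_det, hN', hdet, map_zero]
  obtain ⟨v, hv0, hv⟩ := Matrix.exists_mulVec_eq_zero_iff.2 hdet'
  refine ⟨fun i => v i, fun h => hv0 (funext fun i => ?_), fun i => (v i).2, funext fun i => ?_⟩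
  · exact Subtype.ext (congrFun h i)
  · have := RingHom.map_mulVec (algebraMap M Ω) N' v i
    rw [hv] at this
    exact this.symm

/-- A pencil of matrices has a singular member, found by an equation of degree equal to the
size of the matrices. -/
theorem exists_singular_pencil [IsAlgClosed Ω] (hn : n ≠ 0) {M : IntermediateField F Ω}
    {a b : Matrix (Fin n) (Fin n) Ω} (ha : ∀ i j, a i j ∈ M) (hb : ∀ i j, b i j ∈ M) :
    ∃ (p : Polynomial Ω) (θ l m : Ω), (∀ i, p.coeff i ∈ M) ∧ p ≠ 0 ∧ p.IsRoot θ ∧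
      (p.natDegree = n ∨ p.natDegree = 1) ∧
      (∀ M' : IntermediateField F Ω, θ ∈ M' → l ∈ M' ∧ m ∈ M') ∧
      (l ≠ 0 ∨ m ≠ 0) ∧ (l • a + m • b).det = 0 := by
  -- If `a` is itself singular, no equation is needed, and the linear polynomial `X` serves as a
  -- dummy.
  by_cases hdet : a.det = 0
  · refine ⟨X, 0, 1, 0, fun i => ?_, X_ne_zero, by simp, Or.inr natDegree_X,
      fun M' _ => ⟨one_mem M', zero_mem M'⟩, Or.inl one_ne_zero, by simpa using hdet⟩
    rw [coeff_X]
    split_ifs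
    exacts [one_mem M, zero_mem M]
  set p : Polynomial Ω := Matrix.det ((X : Polynomial Ω) • a.map C + b.map C) with hp
  have hcoeff : p.coeff n = a.det := by
    simpa using coeff_det_X_add_C_card a b
  have hp0 : p ≠ 0 := fun h => hdet (by rw [← hcoeff, h, coeff_zero])
  have hdeg : p.natDegree = n := by
    refine le_antisymm (by simpa using natDegree_det_X_add_C_le a b)
      (le_natDegree_of_ne_zero (by rwa [hcoeff]))
  obtain ⟨θ, hθ⟩ := IsAlgClosed.exists_root p (by
    rw [degree_eq_natDegree hp0, hdeg]
    exact_mod_cast hn)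
  refine ⟨p, θ, θ, 1, fun i => ?_, hp0, hθ, Or.inl hdeg, fun M' h => ⟨h, one_mem M'⟩,
    Or.inr one_ne_zero, ?_⟩
  · set a' : Matrix (Fin n) (Fin n) M := Matrix.of fun i j => ⟨a i j, ha i j⟩
    set b' : Matrix (Fin n) (Fin n) M := Matrix.of fun i j => ⟨b i j, hb i j⟩
    have : (Matrix.det ((X : Polynomial M) • a'.map C + b'.map C)).map (algebraMap M Ω) = p := by
      rw [← coe_mapRingHom, RingHom.map_det, hp]
      congr 1
      ext1 i j
      simp [a', b', Matrix.add_apply, Matrix.smul_apply]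
    rw [← this, coeff_map]
    exact SetLike.coe_mem _
  · rw [IsRoot, hp, ← coe_evalRingHom, RingHom.map_det] at hθ
    rw [← hθ]
    congr 1
    ext1 i j
    simpa [Matrix.add_apply, Matrix.smul_apply] using mul_comm _ _

end Pencil

/-! ### Parametrization of a conic and its intersection with a cubic -/

section Conic

variable {F Ω B : Type*} [Field F] [Field Ω] [Algebra F Ω] [CommRing B] [Algebra Ω B]

/-- The second intersection of the quadric `κ (z ^ 2) = 0` with the line joining its point `u`
to `w`. -/
def conicPoint (κ : B →ₗ[Ω] Ω) (u w : B) : B := κ (w * w) • u - (2 * κ (u * w)) • w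

theorem conicPoint_isotropic {κ : B →ₗ[Ω] Ω} {u : B} (hu : κ (u * u) = 0) (w : B) :
    κ (conicPoint κ u w ^ 2) = 0 := by
  have : conicPoint κ u w ^ 2 = κ (w * w) ^ 2 • (u * u) -
      (4 * κ (w * w) * κ (u * w)) • (u * w) + (4 * κ (u * w) ^ 2) • (w * w) := by
    simp only [conicPoint, Algebra.smul_def, map_mul, map_pow, map_ofNat]
    ring
  rw [this, map_add, map_sub, map_smul, map_smul, map_smul, hu]
  simp only [smul_eq_mul]
  ring

/-- A point on the intersection of a rational conic with a cubic is found by an equation of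
degree six. -/
theorem exists_conicPoint_pow_three_eq_zero [IsAlgClosed Ω] {M : IntermediateField F Ω}
    {A : Subalgebra M B} {κ τ : B →ₗ[Ω] Ω}
    (hκ : ∀ z ∈ A, κ z ∈ M) (hτ : ∀ z ∈ A, τ z ∈ M) {u g₀ g₁ : B} (hu : u ∈ A) (hg₀ : g₀ ∈ A)
    (hg₁ : g₁ ∈ A) :
    ∃ (p : Polynomial Ω) (θ s t : Ω), (∀ i, p.coeff i ∈ M) ∧ p ≠ 0 ∧ p.IsRoot θ ∧
      (p.natDegree = 6 ∨ p.natDegree = 1) ∧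
      (∀ M' : IntermediateField F Ω, θ ∈ M' → s ∈ M' ∧ t ∈ M') ∧
      (s ≠ 0 ∨ t ≠ 0) ∧ τ (conicPoint κ u (s • g₀ + t • g₁) ^ 3) = 0 := by
  -- This value is the coefficient of `t ^ 6` in the sextic for `g₀ + t • g₁`; if it vanishes, the
  -- parameter at infinity is a solution and `X` is a dummy equation.
  by_cases h : τ (conicPoint κ u g₁ ^ 3) = 0
  · refine ⟨X, 0, 0, 1, fun i => ?_, X_ne_zero, by simp, Or.inr natDegree_X,
      fun M' _ => ⟨zero_mem M', one_mem M'⟩, Or.inr one_ne_zero, by simpa using h⟩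
    rw [coeff_X]
    split_ifs
    exacts [one_mem M, zero_mem M]
  have h2 : (2 : Ω) ∈ M := ofNat_mem M 2
  -- `a₀`, `a₁`, `a₂` are the coefficients of `conicPoint κ u (g₀ + t • g₁)` as a quadratic
  -- polynomial in `t`; `a₁` is the polarization.
  set a₀ : B := conicPoint κ u g₀ with ha₀
  set a₁ : B := (2 * κ (g₀ * g₁)) • u - ((2 * κ (u * g₀)) • g₁ + (2 * κ (u * g₁)) • g₀) with ha₁
  set a₂ : B := conicPoint κ u g₁ with ha₂
  have hA₀ : a₀ ∈ A := sub_mem (smul_mem_of_mem (hκ _ (mul_mem hg₀ hg₀)) hu)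
    (smul_mem_of_mem (mul_mem h2 (hκ _ (mul_mem hu hg₀))) hg₀)
  have hA₁ : a₁ ∈ A := sub_mem (smul_mem_of_mem (mul_mem h2 (hκ _ (mul_mem hg₀ hg₁))) hu)
    (add_mem (smul_mem_of_mem (mul_mem h2 (hκ _ (mul_mem hu hg₀))) hg₁)
      (smul_mem_of_mem (mul_mem h2 (hκ _ (mul_mem hu hg₁))) hg₀))
  have hA₂ : a₂ ∈ A := sub_mem (smul_mem_of_mem (hκ _ (mul_mem hg₁ hg₁)) hu)
    (smul_mem_of_mem (mul_mem h2 (hκ _ (mul_mem hu hg₁))) hg₁)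
  have hpoint : ∀ t : Ω, a₂ * algebraMap Ω B t ^ 2 + a₁ * algebraMap Ω B t + a₀ =
      conicPoint κ u ((1 : Ω) • g₀ + t • g₁) := by
    intro t
    have e1 : (g₀ + t • g₁) * (g₀ + t • g₁) =
        g₀ * g₀ + (2 * t) • (g₀ * g₁) + t ^ 2 • (g₁ * g₁) := by
      simp only [Algebra.smul_def, map_mul, map_pow, map_ofNat]
      ring
    have e2 : u * (g₀ + t • g₁) = u * g₀ + t • (u * g₁) := by
      simp only [Algebra.smul_def]
      ring
    rw [one_smul, ha₂, ha₁, ha₀]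
    simp only [conicPoint]
    rw [e1, e2]
    simp only [map_add, map_smul, smul_eq_mul]
    simp only [map_add, Algebra.smul_def, map_mul, map_pow, map_ofNat]
    ring
  set Y : B[X] := C a₂ * X ^ 2 + C a₁ * X + C a₀ with hY
  have hYdeg : Y.natDegree ≤ 2 := natDegree_quadratic_le
  obtain ⟨p, hp, hpe⟩ := exists_polynomial_coeff_eq τ (Y ^ 3)
  have hdeg : p.natDegree ≤ 6 := natDegree_le_of_coeff_eq hp (natDegree_pow_le_of_le 3 hYdeg)
  have hp6 : p.coeff 6 ≠ 0 := by
    have := coeff_pow_of_natDegree_le (m := 3) hYdeg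
    norm_num at this
    rw [hp, this]
    simpa [hY] using h
  have hp0 : p ≠ 0 := fun h => hp6 (by simp [h])
  have hdeg' : p.natDegree = 6 := le_antisymm hdeg (le_natDegree_of_ne_zero hp6)
  obtain ⟨θ, hθ⟩ := IsAlgClosed.exists_root p (by
    rw [degree_eq_natDegree hp0, hdeg']
    norm_num)
  refine ⟨p, θ, 1, θ, fun i => ?_, hp0, hθ, Or.inl hdeg', fun M' h => ⟨one_mem M', h⟩,
    Or.inl one_ne_zero, ?_⟩
  · rw [hp]
    have hmem : Y ∈ lifts (A.val : A →+* B) := by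
      rw [hY]
      exact add_mem (add_mem
        (mul_mem (C'_mem_lifts (f := (A.val : A →+* B)) ⟨⟨a₂, hA₂⟩, rfl⟩)
          (pow_mem (X_mem_lifts _) 2))
        (mul_mem (C'_mem_lifts ⟨⟨a₁, hA₁⟩, rfl⟩) (X_mem_lifts _)))
        (C'_mem_lifts ⟨⟨a₀, hA₀⟩, rfl⟩)
    obtain ⟨c, hc⟩ := (lifts_iff_coeff_lifts _).1 (pow_mem hmem 3) i
    exact hτ _ (hc ▸ c.2)
  · have := hpe θ
    rw [hθ.eq_zero] at this
    rw [← hpoint, this, hY]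
    simp

end Conic


/-! ### Tangent directions, the isotropic 3-space and the final line -/

section Construction

variable {F Ω B : Type*} [Field F] [Field Ω] [Algebra F Ω] [CommRing B] [Algebra Ω B]

theorem span_le_span_of_forall_mem {ι κ : Type*} {u : ι → B} {v : κ → B}
    (h : ∀ i, u i ∈ Submodule.span Ω (Set.range v)) :
    Submodule.span Ω (Set.range u) ≤ Submodule.span Ω (Set.range v) :=
  Submodule.span_le.2 (by rintro _ ⟨i, rfl⟩; exact h i)

theorem span_comp_le {ι κ : Type*} (v : κ → B) (f : ι → κ) :
    Submodule.span Ω (Set.range (v ∘ f)) ≤ Submodule.span Ω (Set.range v) :=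
  Submodule.span_mono (Set.range_comp_subset_range _ _)

theorem linearIndependent_pair_of_notMem_span {u w : B} {S : Submodule Ω B} (hu : u ∉ S)
    (hw : w ∈ S) (hw0 : w ≠ 0) : LinearIndependent Ω ![u, w] := by
  rw [LinearIndependent.pair_iff' (fun h => hu (by rw [h]; exact S.zero_mem))]
  intro a ha
  have ha0 : a ≠ 0 := fun h => hw0 (by rw [← ha, h, zero_smul])
  rw [← ha, Submodule.smul_mem_iff _ ha0] at hw
  exact hu hw

variable [IsAlgClosed Ω] {M : IntermediateField F Ω} {A : Subalgebra M B}

/-- A rational point `P` of the intersection of the quadric and the cubic, together with five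
independent directions tangent to both at `P`. -/
theorem exists_tangent_frame (hM : QuarticClosed M) {τ : B →ₗ[Ω] Ω} (hτ : ∀ z ∈ A, τ z ∈ M)
    {v : Fin 8 → B} (hv : LinearIndependent Ω v) (hvA : ∀ i, v i ∈ A) (hvτ : ∀ i, τ (v i) = 0) :
    ∃ P ∈ A, τ P = 0 ∧ τ (P ^ 2) = 0 ∧ τ (P ^ 3) = 0 ∧
      ∃ w : Fin 5 → B, LinearIndependent Ω w ∧ (∀ i, w i ∈ A) ∧
        P ∉ Submodule.span Ω (Set.range w) ∧ (∀ i, τ (w i) = 0) ∧ (∀ i, τ (P * w i) = 0) ∧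
        ∀ i, τ (P ^ 2 * w i) = 0 := by
  -- Four of the eight vectors suffice for a line on the quadric; a cubic equation on that line
  -- gives `P`. Of a 7-dimensional complement of `P`, the two tangency conditions leave five
  -- dimensions.
  obtain ⟨u, hu, huA, huv, huτ⟩ := exists_isotropic_plane hM hτ
    (hv.comp (Fin.castLE (by norm_num : 4 ≤ 8)) (Fin.castLE_injective _)) (fun i => hvA _)
  obtain ⟨P, hPA, hP0, hPu, hP⟩ := exists_pow_eq_zero hM hτ hu huA (m := 3) (by norm_num)
    (by norm_num)
  have hPv : P ∈ Submodule.span Ω (Set.range v) :=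
    span_comp_le v _ (span_le_span_of_forall_mem huv hPu)
  obtain ⟨j, hj⟩ := exists_notMem_span_succAbove hv hP0 hPv
  obtain ⟨w, hw, hwA, hwv, hwτ⟩ := exists_linearIndependent_ker (A := A) (n := 6)
    (hv.comp _ Fin.succAbove_right_injective) (fun i => hvA (j.succAbove i))
    (τ := τ ∘ₗ LinearMap.mulLeft Ω P) (fun z hz => hτ _ (mul_mem hPA hz))
  obtain ⟨w', hw', hwA', hwv', hwτ'⟩ := exists_linearIndependent_ker (A := A) (n := 5) hw hwA
    (τ := τ ∘ₗ LinearMap.mulLeft Ω (P ^ 2)) (fun z hz => hτ _ (mul_mem (pow_mem hPA 2) hz))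
  have hle := span_le_span_of_forall_mem hwv
  refine ⟨P, hPA, linearMap_eq_zero_of_mem_span hvτ hPv, ?_, hP, w', hw', hwA', fun h => hj ?_,
    fun i => ?_, fun i => ?_, hwτ'⟩
  · rw [pow_two]
    exact mul_eq_zero_of_mem_span huτ hPu hPu
  · exact hle (span_le_span_of_forall_mem hwv' h)
  · exact linearMap_eq_zero_of_mem_span hvτ (span_comp_le v _ (hle (hwv' i)))
  · exact linearMap_eq_zero_of_mem_span (τ := τ ∘ₗ LinearMap.mulLeft Ω P) hwτ (hwv' i)

/-- A singular quadric in five variables contains a plane; it is rational if the vertex is. -/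
theorem exists_isotropic_space (hM : QuarticClosed M) {τ : B →ₗ[Ω] Ω} (hτ : ∀ z ∈ A, τ z ∈ M)
    {w : Fin 5 → B} (hw : LinearIndependent Ω w) (hwA : ∀ i, w i ∈ A) {D : B} (hDA : D ∈ A)
    (hD0 : D ≠ 0) (hDw : D ∈ Submodule.span Ω (Set.range w)) (hD : ∀ i, τ (D * w i) = 0) :
    ∃ R : Fin 3 → B, LinearIndependent Ω R ∧ (∀ i, R i ∈ A) ∧
      (∀ i, R i ∈ Submodule.span Ω (Set.range w)) ∧ ∀ i j, τ (R i * R j) = 0 := by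
  obtain ⟨j, hj⟩ := exists_notMem_span_succAbove hw hD0 hDw
  -- The quadric is a cone with vertex `D`: join `D` to an isotropic plane in a 4-dimensional
  -- complement.
  obtain ⟨u, hu, huA, huw, huτ⟩ := exists_isotropic_plane hM hτ
    (hw.comp _ (Fin.succAbove_right_injective (p := j))) (fun i => hwA _)
  have huw' : ∀ i, u i ∈ Submodule.span Ω (Set.range w) := fun i => span_comp_le w _ (huw i)
  have hDz : ∀ z ∈ Submodule.span Ω (Set.range w), τ (D * z) = 0 := fun z hz =>
    linearMap_eq_zero_of_mem_span (τ := τ ∘ₗ LinearMap.mulLeft Ω D) hD hz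
  refine ⟨Fin.cons D u, ?_, ?_, ?_, ?_⟩
  · rw [linearIndependent_finCons]
    exact ⟨hu, fun h => hj (span_le_span_of_forall_mem huw h)⟩
  · exact Fin.cases hDA huA
  · exact Fin.cases hDw huw'
  · refine Fin.cases (Fin.cases (hDz _ hDw) fun i => hDz _ (huw' i)) fun i =>
      Fin.cases ?_ fun i' => huτ i i'
    rw [mul_comm]
    exact hDz _ (huw' i)

/-- If the point of the conic on the line joining `u` to `w` is undefined, then the conic contains
the line, which meets the cubic in a rational point. -/
theorem exists_common_zero_of_conicPoint [CharZero Ω] (hM : QuarticClosed M) {τ κ : B →ₗ[Ω] Ω}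
    (hτ : ∀ z ∈ A, τ z ∈ M) (hκ : ∀ z ∈ A, κ z ∈ M) {u w : B} (hu : u ∈ A) (hw : w ∈ A)
    (huw : LinearIndependent Ω ![u, w]) (huκ : κ (u * u) = 0)
    (hz : τ (conicPoint κ u w ^ 3) = 0) :
    ∃ z ∈ A, z ≠ 0 ∧ z ∈ Submodule.span Ω (Set.range ![u, w]) ∧ κ (z ^ 2) = 0 ∧
      τ (z ^ 3) = 0 := by
  have hus : u ∈ Submodule.span Ω (Set.range ![u, w]) := Submodule.subset_span ⟨0, rfl⟩
  have hws : w ∈ Submodule.span Ω (Set.range ![u, w]) := Submodule.subset_span ⟨1, rfl⟩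
  by_cases h0 : conicPoint κ u w = 0
  · have h := LinearIndependent.pair_iff.1 huw (κ (w * w)) (-(2 * κ (u * w)))
      (by rw [neg_smul, ← sub_eq_add_neg]; exact h0)
    have hww : κ (w * w) = 0 := h.1
    have huw0 : κ (u * w) = 0 := by simpa using h.2
    have hiso : ∀ i j, κ (![u, w] i * ![u, w] j) = 0 := by
      simp only [Fin.forall_fin_two, Matrix.cons_val_zero, Matrix.cons_val_one]
      exact ⟨⟨huκ, huw0⟩, by rwa [mul_comm], hww⟩
    obtain ⟨e, heA, he0, hes, he⟩ := exists_pow_eq_zero hM hτ huw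
      (by simpa [Fin.forall_fin_two] using ⟨hu, hw⟩) (m := 3) (by norm_num) (by norm_num)
    refine ⟨e, heA, he0, hes, ?_, he⟩
    rw [pow_two]
    exact mul_eq_zero_of_mem_span hiso hes hes
  · exact ⟨conicPoint κ u w, sub_mem (smul_mem_of_mem (hκ _ (mul_mem hw hw)) hu)
      (smul_mem_of_mem (mul_mem (ofNat_mem M 2) (hκ _ (mul_mem hu hw))) hw), h0,
      sub_mem (Submodule.smul_mem _ _ hus) (Submodule.smul_mem _ _ hws),
      conicPoint_isotropic huκ w, hz⟩

/-- On the line joining `P` to a common zero of the polar forms at `P` there is a rational point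
with vanishing power sums up to the fourth. -/
theorem exists_pow_four_eq_zero (hM : QuarticClosed M) {τ : B →ₗ[Ω] Ω} (hτ : ∀ z ∈ A, τ z ∈ M)
    {P z : B} (hPA : P ∈ A) (hzA : z ∈ A) (hPz : LinearIndependent Ω ![P, z])
    (hP1 : τ P = 0) (hP2 : τ (P ^ 2) = 0) (hP3 : τ (P ^ 3) = 0) (hz1 : τ z = 0)
    (hz2 : τ (z ^ 2) = 0) (hz3 : τ (z ^ 3) = 0) (h11 : τ (P * z) = 0) (h21 : τ (P ^ 2 * z) = 0)
    (h12 : τ (P * z ^ 2) = 0) :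
    ∃ y ∈ A, y ≠ 0 ∧ τ y = 0 ∧ τ (y ^ 2) = 0 ∧ τ (y ^ 3) = 0 ∧ τ (y ^ 4) = 0 := by
  obtain ⟨y, hyA, hy0, hys, hy4⟩ := exists_pow_eq_zero hM hτ hPz
    (by simpa [Fin.forall_fin_two] using ⟨hPA, hzA⟩) (m := 4) (by norm_num) (by norm_num)
  refine ⟨y, hyA, hy0, ?_, ?_, ?_, hy4⟩ <;>
    (obtain ⟨c, rfl⟩ := (Submodule.mem_span_range_iff_exists_fun Ω).1 hys
     simp only [Fin.sum_univ_two, Matrix.cons_val_zero, Matrix.cons_val_one])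
  · simp [hP1, hz1]
  · have : (c 0 • P + c 1 • z) ^ 2 =
        c 0 ^ 2 • P ^ 2 + (2 * c 0 * c 1) • (P * z) + c 1 ^ 2 • z ^ 2 := by
      simp only [Algebra.smul_def, map_mul, map_pow, map_ofNat]
      ring
    rw [this]
    simp [hP2, h11, hz2]
  · have : (c 0 • P + c 1 • z) ^ 3 =
        c 0 ^ 3 • P ^ 3 + (3 * c 0 ^ 2 * c 1) • (P ^ 2 * z) +
          (3 * c 0 * c 1 ^ 2) • (P * z ^ 2) + c 1 ^ 3 • z ^ 3 := by
      simp only [Algebra.smul_def, map_mul, map_pow, map_ofNat]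
      ring
    rw [this]
    simp [hP3, h21, h12, hz3]

end Construction


/-! ### Assembling the tower and the solution -/

section TowerSolution

variable {F Ω : Type*} [Field F] [Field Ω] [Algebra F Ω]

/-- The sum of the values at the nine points. -/
def valueSum (Ω : Type*) [Field Ω] : (Fin 9 → Ω) →ₗ[Ω] Ω := ∑ i, LinearMap.proj i

theorem valueSum_apply (v : Fin 9 → Ω) : valueSum Ω v = ∑ i, v i := by
  simp [valueSum]

/-- These are the columns of a Vandermonde matrix. -/
theorem linearIndependent_powers {x : Fin 9 → Ω} (hinj : Function.Injective x) :
    LinearIndependent Ω fun j : Fin 9 => x ^ (j : ℕ) := by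
  have h := Matrix.linearIndependent_cols_of_det_ne_zero
    (Matrix.det_vandermonde_ne_zero_iff.2 hinj)
  exact h

/-- Degree one is allowed for the two special steps because degenerate cases use the dummy equation
`X`. -/
theorem AuxTower.extend_quintic_sextic {E₀ E₁ E₂ E₃ E₄ : IntermediateField F Ω} {m n : ℕ}
    (h₀ : QuarticTower ⊥ E₀) (h₁ : AdjoinStep m E₀ E₁) (h₂ : QuarticTower E₁ E₂)
    (h₃ : AdjoinStep n E₂ E₃) (h₄ : QuarticTower E₃ E₄) (hm : m = 5 ∨ m = 1)
    (hn : n = 6 ∨ n = 1) :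
    ∃ degs : List ℕ, AuxTower degs E₄ ∧ (∀ d ∈ degs, d ≤ 6) ∧ degs.count 5 ≤ 1 ∧
      degs.count 6 ≤ 1 := by
  obtain ⟨d₀, hd₀, t₀⟩ := h₀.auxTower AuxTower.base
  obtain ⟨d₁, hd₁, t₁⟩ := h₂.auxTower (t₀.adjoinStep h₁)
  obtain ⟨d₂, hd₂, t₂⟩ := h₄.auxTower (t₁.adjoinStep h₃)
  have hcount : ∀ (l : List ℕ), (∀ d ∈ l, d ≤ 4) → l.count 5 = 0 ∧ l.count 6 = 0 :=
    fun l hl => ⟨List.count_eq_zero.2 fun h => absurd (hl _ h) (by norm_num),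
      List.count_eq_zero.2 fun h => absurd (hl _ h) (by norm_num)⟩
  refine ⟨_, t₂, ?_, ?_, ?_⟩
  · intro d hd
    simp only [List.mem_append, List.mem_cons, List.append_nil] at hd
    rcases hd with h | rfl | h | rfl | h
    · exact (hd₂ d h).trans (by norm_num)
    · omega
    · exact (hd₁ d h).trans (by norm_num)
    · omega
    · exact (hd₀ d h).trans (by norm_num)
  · rcases hm with rfl | rfl <;> rcases hn with rfl | rfl <;>
      simp [List.count_append, hcount _ hd₀, hcount _ hd₁, hcount _ hd₂]
  · rcases hm with rfl | rfl <;> rcases hn with rfl | rfl <;>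
      simp [List.count_append, hcount _ hd₀, hcount _ hd₁, hcount _ hd₂]

/-- A kernel vector of the Gram matrix gives a vertex of the quadric. -/
theorem exists_kernel_vector_of_pencil {B : Type*} [CommRing B] [Algebra Ω B] {n : ℕ}
    {τ : B →ₗ[Ω] Ω} {w : Fin n → B} {d : Fin n → Ω}
    (hd : (Matrix.of fun i j => τ (w i * w j)).mulVec d = 0) (j : Fin n) :
    τ ((∑ i, d i • w i) * w j) = 0 := by
  have h := congrFun hd j
  rw [Finset.sum_mul, map_sum]
  refine Eq.trans ?_ h
  rw [Matrix.mulVec, dotProduct]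
  refine Finset.sum_congr rfl fun i _ => ?_
  rw [smul_mul_assoc, map_smul, smul_eq_mul, mul_comm, Matrix.of_apply, mul_comm (w i)]

/-- Over a field reached by auxiliary equations of degree at most six, of which at most one has
degree five and at most one has degree six, there is a nonzero equivariant family whose first four
power sums vanish. -/
theorem exists_auxTower_powerSums_eq_zero [CharZero Ω] [IsAlgClosed Ω] [IsGalois F Ω]
    {x : Fin 9 → Ω} (hinj : Function.Injective x)
    (hperm : ∀ σ : Ω ≃ₐ[F] Ω, ∃ π : Equiv.Perm (Fin 9), ∀ i, σ (x i) = x (π i)) :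
    ∃ (degs : List ℕ) (L : IntermediateField F Ω), AuxTower degs L ∧ (∀ d ∈ degs, d ≤ 6) ∧
      degs.count 5 ≤ 1 ∧ degs.count 6 ≤ 1 ∧ ∃ y ∈ equivariantSubalgebra x L, y ≠ 0 ∧
        ∀ m, 0 < m → m ≤ 4 → ∑ i, y i ^ m = 0 := by
  classical
  have hsum : ∀ M : IntermediateField F Ω, ∀ v ∈ equivariantSubalgebra x M, valueSum Ω v ∈ M :=
    fun M v hv => valueSum_apply v ▸ sum_mem_of_mem_equivariantSubalgebra hperm hv
  have hmono : ∀ {M M' : IntermediateField F Ω}, M ≤ M' → ∀ {v : Fin 9 → Ω},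
      v ∈ equivariantSubalgebra x M → v ∈ equivariantSubalgebra x M' :=
    fun h _ hv => equivariantSubalgebra_mono h hv
  set τ := valueSum Ω with hτ
  have hM₀ := quarticClosed_quarticClosure (⊥ : IntermediateField F Ω)
  obtain ⟨v, hv, hvA, -, hvτ⟩ := exists_linearIndependent_ker
    (A := equivariantSubalgebra x (quarticClosure (⊥ : IntermediateField F Ω)))
    (linearIndependent_powers hinj) (fun j => pow_mem (self_mem_equivariantSubalgebra _) _)
    (hsum _)
  obtain ⟨P, hPA, hP1, hP2, hP3, w, hw, hwA, hPw, hw1, hw11, hw21⟩ :=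
    exists_tangent_frame hM₀ (hsum _) hv hvA hvτ
  obtain ⟨p, θ, l, m, hpM, hp0, hpθ, hpdeg, hlm, hlm0, hdet⟩ := exists_singular_pencil
    (M := quarticClosure (⊥ : IntermediateField F Ω)) (n := 5) (by norm_num)
    (a := Matrix.of fun i j => τ (w i * w j)) (b := Matrix.of fun i j => τ (P * (w i * w j)))
    (fun i j => hsum _ _ (mul_mem (hwA i) (hwA j)))
    (fun i j => hsum _ _ (mul_mem hPA (mul_mem (hwA i) (hwA j))))
  obtain ⟨E₀, E₁, h₀, h₁, hle₁, hθ⟩ := exists_adjoinStep_quarticClosure p θ hpM hp0 hpθ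
  have hM₁ := quarticClosed_quarticClosure E₁
  obtain ⟨hl, hm⟩ := hlm _ hθ
  set τ' : (Fin 9 → Ω) →ₗ[Ω] Ω := l • τ + m • (τ ∘ₗ LinearMap.mulLeft Ω P) with hτ'
  have hτ'mem : ∀ z ∈ equivariantSubalgebra x (quarticClosure E₁),
      τ' z ∈ quarticClosure E₁ := fun z hz =>
    add_mem (mul_mem hl (hsum _ z hz)) (mul_mem hm (hsum _ _ (mul_mem (hmono hle₁ hPA) hz)))
  obtain ⟨d, hd0, hdM, hd⟩ := exists_mulVec_eq_zero_of_mem (M := quarticClosure E₁)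
    (N := Matrix.of fun i j => τ' (w i * w j))
    (fun i j => hτ'mem _ (mul_mem (hmono hle₁ (hwA i)) (hmono hle₁ (hwA j)))) hdet
  obtain ⟨R, hR, hRA, hRw, hRτ⟩ := exists_isotropic_space hM₁ hτ'mem hw
    (fun i => hmono hle₁ (hwA i)) (D := ∑ i, d i • w i)
    (sum_mem fun i _ => smul_mem_of_mem (hdM i) (hmono hle₁ (hwA i)))
    (fun h => hd0 (funext (Fintype.linearIndependent_iff.1 hw d h)))
    (sum_mem fun i _ => Submodule.smul_mem _ _ (Submodule.subset_span ⟨i, rfl⟩))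
    (exists_kernel_vector_of_pencil hd)
  -- `κ` is a second generator of the pencil: whichever of `τ (P * ·)` and `τ` is independent of the
  -- singular member `τ'`.
  obtain ⟨κ, hκmem, hκ⟩ : ∃ κ : (Fin 9 → Ω) →ₗ[Ω] Ω,
      (∀ M, quarticClosure E₁ ≤ M → ∀ z ∈ equivariantSubalgebra x M, κ z ∈ M) ∧
      ∀ z, τ' z = 0 → κ z = 0 → τ z = 0 ∧ τ (P * z) = 0 := by
    have hτ'z : ∀ z, τ' z = l * τ z + m * τ (P * z) := fun z => rfl
    by_cases hm0 : m = 0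
    · refine ⟨τ ∘ₗ LinearMap.mulLeft Ω P,
        fun M hM z hz => hsum M _ (mul_mem (hmono (hle₁.trans hM) hPA) hz),
        fun z h1 h2 => ⟨?_, h2⟩⟩
      rw [hτ'z, hm0, zero_mul, add_zero] at h1
      exact (mul_eq_zero.1 h1).resolve_left (hlm0.resolve_right (not_not.2 hm0))
    · refine ⟨τ, fun M _ => hsum M, fun z h1 h2 => ⟨h2, ?_⟩⟩
      rw [hτ'z, h2, mul_zero, zero_add] at h1
      exact (mul_eq_zero.1 h1).resolve_left hm0
  obtain ⟨u, huA, hu0, huR, hu⟩ := exists_pow_eq_zero hM₁ (hκmem _ le_rfl)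
    (hR.comp (Fin.castLE (by norm_num : 2 ≤ 3)) (Fin.castLE_injective _)) (fun i => hRA _)
    (m := 2) (by norm_num) (by norm_num)
  -- The lines through the conic's point `u` are parametrized by a line in the plane that misses
  -- `u`.
  obtain ⟨j, hj⟩ := exists_notMem_span_succAbove hR hu0 (span_comp_le R _ huR)
  have hg := hR.comp _ (Fin.succAbove_right_injective (p := j))
  obtain ⟨q, η, s, t, hqM, hq0, hqη, hqdeg, hst, hst0, hzero⟩ :=
    exists_conicPoint_pow_three_eq_zero (hκmem _ le_rfl) (hsum _) huA
      (hRA (j.succAbove 0)) (hRA (j.succAbove 1))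
  obtain ⟨E₂, E₃, h₂, h₃, hle₃, hη⟩ := exists_adjoinStep_quarticClosure q η hqM hq0 hqη
  have hM₃ := quarticClosed_quarticClosure E₃
  obtain ⟨hs, ht⟩ := hst _ hη
  set W := s • R (j.succAbove 0) + t • R (j.succAbove 1) with hW
  have hWs : W ∈ Submodule.span Ω (Set.range (R ∘ j.succAbove)) :=
    add_mem (Submodule.smul_mem _ _ (Submodule.subset_span ⟨0, rfl⟩))
      (Submodule.smul_mem _ _ (Submodule.subset_span ⟨1, rfl⟩))
  have hW0 : W ≠ 0 := by
    intro h
    have := Fintype.linearIndependent_iff.1 hg ![s, t]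
      (by simpa [Fin.sum_univ_two] using h)
    have hs0 : s = 0 := this 0
    have ht0 : t = 0 := this 1
    exact hst0.elim (fun h => h hs0) (fun h => h ht0)
  obtain ⟨z, hzA, hz0, hzs, hzκ, hz3⟩ := exists_common_zero_of_conicPoint hM₃ (hsum _)
    (hκmem _ hle₃) (hmono hle₃ huA)
    (add_mem (smul_mem_of_mem hs (hmono hle₃ (hRA _))) (smul_mem_of_mem ht (hmono hle₃ (hRA _))))
    (linearIndependent_pair_of_notMem_span hj hWs hW0) (by rwa [← pow_two]) hzero
  have hzR : z ∈ Submodule.span Ω (Set.range R) := by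
    refine span_le_span_of_forall_mem ?_ hzs
    simpa [Fin.forall_fin_two] using ⟨span_comp_le R _ huR, span_comp_le R _ hWs⟩
  have hzw := span_le_span_of_forall_mem hRw hzR
  obtain ⟨hz2, h12⟩ := hκ (z ^ 2)
    (by rw [pow_two]; exact mul_eq_zero_of_mem_span hRτ hzR hzR) hzκ
  obtain ⟨y, hyA, hy0, hy1, hy2, hy3, hy4⟩ := exists_pow_four_eq_zero hM₃ (hsum _)
    (hmono (hle₁.trans hle₃) hPA) hzA (linearIndependent_pair_of_notMem_span hPw hzw hz0)
    hP1 hP2 hP3 (linearMap_eq_zero_of_mem_span hw1 hzw) hz2 hz3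
    (linearMap_eq_zero_of_mem_span (τ := τ ∘ₗ LinearMap.mulLeft Ω P) hw11 hzw)
    (linearMap_eq_zero_of_mem_span (τ := τ ∘ₗ LinearMap.mulLeft Ω (P ^ 2)) hw21 hzw) h12
  obtain ⟨a, haM, hay⟩ := exists_tschirnhausValue_eq hperm
    (self_mem_equivariantSubalgebra _) hyA hinj
  -- Only the nine parameters of `y` need to be reached, so a finite tower replaces the quartic
  -- closure.
  obtain ⟨E₄, h₄, ha₄⟩ := exists_quarticTower_of_finset (Finset.univ.image a) (E := E₃)
    (by simpa using haM)
  obtain ⟨degs, hdegs⟩ := AuxTower.extend_quintic_sextic h₀ h₁ h₂ h₃ h₄ hpdeg hqdeg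
  refine ⟨degs, E₄, hdegs.1, hdegs.2.1, hdegs.2.2.1, hdegs.2.2.2, y, ?_, hy0, ?_⟩
  · have : y = ∑ j : Fin 9, a j • x ^ (j : ℕ) := by
      funext k
      rw [← hay k, tschirnhausValue, Finset.sum_apply]
      rfl
    rw [this]
    exact sum_mem fun j _ => smul_mem_of_mem (ha₄ _ (Finset.mem_image_of_mem a (Finset.mem_univ j)))
      (pow_mem (self_mem_equivariantSubalgebra _) _)
  · intro m hm0 hm4
    have hval : ∀ n : ℕ, τ (y ^ n) = ∑ i, y i ^ n := fun n => valueSum_apply _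
    rw [← hval]
    interval_cases m
    exacts [by rwa [pow_one], hy2, hy3, hy4]

end TowerSolution

/-! ### From power sums to coefficients -/

section Newton

variable {Ω : Type*} [Field Ω] [CharZero Ω]

/-- Newton's identity expresses `k * e_k` through products each containing a power sum of index
between 1 and `k`; characteristic zero permits division by `k`. -/
theorem aeval_esymm_eq_zero {y : Fin 9 → Ω} {n : ℕ}
    (hy : ∀ m, 0 < m → m ≤ n → ∑ i, y i ^ m = 0) {k : ℕ} (hk0 : k ≠ 0) (hkn : k ≤ n) :
    MvPolynomial.aeval y (MvPolynomial.esymm (Fin 9) Ω k) = 0 := by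
  have h := congrArg (MvPolynomial.aeval y) (MvPolynomial.mul_esymm_eq_sum (Fin 9) Ω k)
  rw [map_mul, map_natCast, map_mul, map_sum, Finset.sum_eq_zero, mul_zero] at h
  · exact (mul_eq_zero.1 h).resolve_left (Nat.cast_ne_zero.2 hk0)
  · intro a ha
    rw [Finset.mem_filter, Finset.HasAntidiagonal.mem_antidiagonal] at ha
    have : MvPolynomial.aeval y (MvPolynomial.psum (Fin 9) Ω a.2) = 0 := by
      simp only [MvPolynomial.psum, map_sum, map_pow, MvPolynomial.aeval_X]
      exact hy a.2 (by omega) (by omega)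
    rw [map_mul, this, mul_zero]

theorem prod_X_sub_C_eq_of_powerSums_eq_zero {y : Fin 9 → Ω}
    (hy : ∀ m, 0 < m → m ≤ 4 → ∑ i, y i ^ m = 0) :
    ∏ i, (X - C (y i)) = X ^ 9 + C ((∏ i, (X - C (y i))).coeff 4) * X ^ 4 +
      C ((∏ i, (X - C (y i))).coeff 3) * X ^ 3 + C ((∏ i, (X - C (y i))).coeff 2) * X ^ 2 +
      C ((∏ i, (X - C (y i))).coeff 1) * X + C ((∏ i, (X - C (y i))).coeff 0) := by
  set q := ∏ i, (X - C (y i)) with hq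
  have hdeg : q.natDegree = 9 := by
    rw [hq, natDegree_prod_of_monic _ _ fun _ _ => monic_X_sub_C _]
    simp
  have hmonic : q.coeff 9 = 1 := by
    have : q.Monic := monic_prod_of_monic _ _ fun _ _ => monic_X_sub_C _
    rwa [Monic, leadingCoeff, hdeg] at this
  have hcoeff : ∀ k, k ≠ 0 → k ≤ 4 → q.coeff (9 - k) = 0 := by
    intro k hk0 hk4
    have hq' : q = ((Finset.univ.val.map y).map fun t => X - C t).prod := by
      rw [hq, Multiset.map_map]
      rfl
    have hcard : (Finset.univ.val.map y).card = 9 := by simp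
    rw [hq', Multiset.prod_X_sub_C_coeff _ (by omega), hcard, Nat.sub_sub_self (by omega),
      ← MvPolynomial.aeval_esymm_eq_multiset_esymm (Fin 9) Ω, aeval_esymm_eq_zero hy hk0 hk4,
      mul_zero]
  have h8 : q.coeff 8 = 0 := hcoeff 1 (by norm_num) (by norm_num)
  have h7 : q.coeff 7 = 0 := hcoeff 2 (by norm_num) (by norm_num)
  have h6 : q.coeff 6 = 0 := hcoeff 3 (by norm_num) (by norm_num)
  have h5 : q.coeff 5 = 0 := hcoeff 4 (by norm_num) (by norm_num)
  conv_lhs => rw [q.as_sum_range_C_mul_X_pow, hdeg]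
  simp only [Finset.sum_range_succ, Finset.sum_range_zero, h5, h6, h7, h8, hmonic, C_0, C_1]
  ring

end Newton


/-! ### The transformed equation and the final theorem -/

theorem tschirnhausTransform_prod {R : Type*} [CommRing R] [IsDomain R] (x a : Fin 9 → R) :
    tschirnhausTransform (∏ i, (X - C (x i))) a = ∏ i, (X - C (tschirnhausValue a (x i))) := by
  have : ∏ i, (X - C (x i)) = ((Finset.univ.val.map x).map fun t => X - C t).prod := by
    rw [Multiset.map_map]
    rfl
  rw [tschirnhausTransform, this, roots_multiset_prod_X_sub_C, Multiset.map_map]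
  rfl

theorem exists_perm_of_algEquiv {K : Type*} [Field K] {x : Fin 9 → Closure K}
    (hx : (generalPoly K).map (algebraMap (CoeffField K) (Closure K)) = ∏ i, (X - C (x i)))
    (σ : Closure K ≃ₐ[CoeffField K] Closure K) :
    ∃ π : Equiv.Perm (Fin 9), ∀ i, σ (x i) = x (π i) := by
  have hroot : ∀ z : Closure K, aeval z (generalPoly K) = 0 ↔ ∃ j, z = x j := by
    intro z
    rw [← eval_map_algebraMap, hx, eval_prod, Finset.prod_eq_zero_iff]
    simp [sub_eq_zero]
  have h : ∀ i, ∃ j, σ (x i) = x j := by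
    intro i
    rw [← hroot]
    have := (hroot (x i)).2 ⟨i, rfl⟩
    rw [aeval_algEquiv, AlgHom.comp_apply, this]
    exact map_zero σ
  choose f hf using h
  have hinj : Function.Injective f := fun i j hij =>
    roots_injective hx (σ.injective (by rw [hf, hf, hij]))
  exact ⟨Equiv.ofBijective f (Finite.injective_iff_bijective.1 hinj), hf⟩

end NinthDegree

end

theorem mainTheorem3 (K : Type*) [Field K] [CharZero K] :
    ∃ (degs : List ℕ)
      (L : IntermediateField (NinthDegree.CoeffField K) (NinthDegree.Closure K)),
      -- `L` arises by auxiliary equations of degree at most six, of which at most one has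
      -- degree five and at most one has degree six
      NinthDegree.AuxTower degs L ∧
      (∀ d ∈ degs, d ≤ 6) ∧ degs.count 5 ≤ 1 ∧ degs.count 6 ≤ 1 ∧
      ∃ a b : Fin 9 → NinthDegree.Closure K,
        (∀ j, a j ∈ L) ∧ (∀ j, b j ∈ L) ∧
        -- the transformation with parameters `a` yields `C₁ = C₂ = C₃ = C₄ = 0`
        (∃ C₅ ∈ L, ∃ C₆ ∈ L, ∃ C₇ ∈ L, ∃ C₈ ∈ L, ∃ C₉ ∈ L,
          NinthDegree.tschirnhausTransform
              ((NinthDegree.generalPoly K).map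
                (algebraMap (NinthDegree.CoeffField K) (NinthDegree.Closure K))) a =
            X ^ 9 + C C₅ * X ^ 4 + C C₆ * X ^ 3 + C C₇ * X ^ 2 + C C₈ * X + C C₉) ∧
        -- the transformation is invertible over `L`, with inverse transformation `b`
        (∀ x : NinthDegree.Closure K, aeval x (NinthDegree.generalPoly K) = 0 →
          NinthDegree.tschirnhausValue b (NinthDegree.tschirnhausValue a x) = x) := by
  obtain ⟨x, hx⟩ := NinthDegree.exists_roots_generalPoly K
  have hinj := NinthDegree.roots_injective hx
  have hperm := NinthDegree.exists_perm_of_algEquiv hx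
  have : CharZero (NinthDegree.CoeffField K) :=
    charZero_of_injective_algebraMap
      (IsFractionRing.injective (MvPolynomial (Fin 9) K) (NinthDegree.CoeffField K))
  have : CharZero (NinthDegree.Closure K) :=
    charZero_of_injective_algebraMap
      (algebraMap (NinthDegree.CoeffField K) (NinthDegree.Closure K)).injective
  have : IsGalois (NinthDegree.CoeffField K) (NinthDegree.Closure K) := {}
  obtain ⟨degs, L, hL, h6, hc5, hc6, y, hyL, hy0, hy⟩ :=
    NinthDegree.exists_auxTower_powerSums_eq_zero hinj hperm
  have hyinj : Function.Injective y := by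
    refine hL.injective_of_ne (NinthDegree.exists_algEquiv_perm_roots hx) h6 hyL ?_
    -- A constant family has first power sum `9 * y 0`, which vanishes only for `y = 0` in
    -- characteristic zero.
    by_contra! hconst
    have hsum := hy 1 one_pos (by norm_num)
    simp only [pow_one, fun i => hconst i 0, Finset.sum_const, Finset.card_univ,
      Fintype.card_fin, nsmul_eq_mul, mul_eq_zero] at hsum
    exact hy0 (funext fun i => (hconst i 0).trans (hsum.resolve_left (by norm_num)))
  obtain ⟨a, haL, ha⟩ := NinthDegree.exists_tschirnhausValue_eq hperm
    (NinthDegree.self_mem_equivariantSubalgebra L) hyL hinj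
  obtain ⟨b, hbL, hb⟩ := NinthDegree.exists_tschirnhausValue_eq hperm hyL
    (NinthDegree.self_mem_equivariantSubalgebra L) hyinj
  have hcoeff := NinthDegree.coeff_prod_mem_of_mem_equivariantSubalgebra hperm hyL
  refine ⟨degs, L, hL, h6, hc5, hc6, a, b, haL, hbL,
    ⟨_, hcoeff 4, _, hcoeff 3, _, hcoeff 2, _, hcoeff 1, _, hcoeff 0, ?_⟩, ?_⟩
  · rw [hx, NinthDegree.tschirnhausTransform_prod,
      ← NinthDegree.prod_X_sub_C_eq_of_powerSums_eq_zero hy]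
    simp_rw [ha]
  · intro z hz
    rw [← eval_map_algebraMap, hx, eval_prod, Finset.prod_eq_zero_iff] at hz
    obtain ⟨k, -, hk⟩ := hz
    rw [eval_sub, eval_X, eval_C, sub_eq_zero] at hk
    rw [hk, ha, hb]
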